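/- Consider a radial (tree) network with slack node $0$ and nodes $1,\dots,J$; branch $j$ joins node $j$ to its upstream node $i=i(j)$. Given are reals $r_j,x_j,G_j,B_j,p_j,q_j$, tap ratios $a_j\neq 0$ and the squared slack voltage $v_0>0$. For $u=(P,Q,l,v)\in\mathbb R^{4J}$ let $Au=b$ denote the $3J$ linear equations, for $j=1,\dots,J$, $$\sum_{j':\,i(j')=j}P_{j'}-P_j+a_j^2r_jl_j+G_jv_j=p_j,\qquad \sum_{j':\,i(j')=j}Q_{j'}-Q_j+a_j^2x_jl_j-B_jv_j=q_j,$$ $$v_j-\frac{v_i}{a_j^2}+2(r_jP_j+x_jQ_j)-a_j^2(r_j^2+x_j^2)l_j=0$$ (terms in $v_0$ are moved to $b$). Let $F(u)_j=v_il_j-P_j^2-Q_j^2$, let $\mathcal M_{QE}=\{u: F(u)=0,\ v_{i(j)}>0\ \text{for all } j\}$ with the Euclidean metric, $T_u\mathcal M_{QE}=\ker DF(u)$, and let $\Pi_u=I-DF(u)^T(DF(u)DF(u)^T)^{-1}DF(u)$ be the orthogonal projection onto $T_u\mathcal M_{QE}$. Put $f(u)=\|Au-b\|_2^2$, $\operatorname{grad}f(u)=\Pi_u\nabla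 f(u)$, $\operatorname{hess}f(u)[\xi]=\Pi_u\,D(\operatorname{grad}f)(u)[\xi]$. A direction at $u$ is a $\zeta\in T_u\mathcal M_{QE}$ with $A(u+\zeta)=b$. Call $u$ regular if the rows of this $4J\times 4J$ linear system for $\zeta$ are linearly independent. With $(\tilde P,\tilde Q,\tilde l,\tilde v)=u+\zeta$ and $D_j=\sqrt{4\tilde P_j^2+4\tilde Q_j^2+(\tilde l_j-\tilde v_i)^2}$, the retraction is either $$R^{QE}_1:\ v_j=\tilde v_j,\quad l_j=\frac{D_j+\tilde l_j-\tilde v_i}{D_j-\tilde l_j+\tilde v_i}\tilde v_i,\quad P_j=\frac{2\tilde P_j\tilde v_i}{D_j-\tilde l_j+\tilde v_i},\quad Q_j=\frac{2\tilde Q_j\tilde v_i}{D_j-\tilde l_j+\tilde v_i},$$ $$\text{or}\quad R^{QE}_2:\ v_j=\tilde v_j,\quad P_j=\tilde P_j,\quad Q_j=\tilde Q_j,\quad l_j=\frac{\tilde P_j^2+\tilde Q_j^2}{\tilde v_i};$$ it is defined where all $\tilde v_{i(j)}>0$ and the denominators do not vanish. Let $\bar\alpha>0$ and $\beta,\sigma\in(0,1)$.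 As long as $\|\operatorname{grad}f(u_k)\|_2>\epsilon$, the method chooses a direction $\zeta_k$ at $u_k$ and sets $u_{k+1}=R_{u_k}(\beta^m\bar\alpha\zeta_k)$ with the smallest integer $m\ge 0$ for which the retraction is defined and $$f(u_k)-f(R_{u_k}(\beta^m\bar\alpha\zeta_k))\ge-\sigma\langle\operatorname{grad}f(u_k),\beta^m\bar\alpha\zeta_k\rangle;$$ once the stopping test holds, the sequence stays constant. Then, for either retraction: 1. (Approximate Newton method.) Let $E_u=-\Pi_uL_u$, where the $n$-th column of $L_u$ is $2(\partial_{u_n}\Pi_u)A^T(Au-b)$. For every $u\in\mathcal M_{QE}$ and every direction $\zeta$ at $u$, $(\operatorname{hess}f(u)+E_u)\zeta=-\operatorname{grad}f(u)$. For every compact set $K$ of regular points of $\mathcal M_{QE}$ there is a $\gamma$ with $\|E_u\|_2\le\gamma\|\operatorname{grad}f(u)\|_2$ for all $u\in K$. 2. (Descent.) If $u\in\mathcal M_{QE}$, $f(u)\ne 0$ and $\zeta$ is a direction at $u$, then $\langle\operatorname{grad}f(u),\zeta\rangle<0$ and Armijo's rule finds a stepsize. For every $\epsilon\ge 0$ all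 iterates lie on $\mathcal M_{QE}$, and $f(u_{k+1})<f(u_k)$ whenever $\|\operatorname{grad}f(u_k)\|_2>\epsilon$. For $\epsilon=0$, every accumulation point of $(u_k)$ that is a regular point of $\mathcal M_{QE}$ is a critical point of $f$. 3. (Local superlinear convergence.) Let $u_*\in\mathcal M_{QE}$ be a regular point with $Au_*=b$, and let $\epsilon=0$. There is a neighbourhood $U$ of $u_*$ such that from every $u_0\in U\cap\mathcal M_{QE}$ the method with full steps, $u_{k+1}=R_{u_k}(\zeta_k)$, can be run, and every sequence it generates converges to $u_*$ with $\|u_{k+1}-u_*\|=o(\|u_k-u_*\|)$. The same holds (with some neighbourhood) for the method with Armijo steps if $\sigma<\tfrac12$ and there is an $m_0\ge 0$ with $\beta^{m_0}\bar\alpha=1$ and $\beta^m\bar\alpha>2(1-\sigma)$ for all $m<m_0$; in particular if $\bar\alpha=1$ and $\sigma<\tfrac12$. -/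

import Mathlib

noncomputable section

/-- A radial distribution network whose non-slack nodes (equivalently, branches) are indexed by
`Fin J`; branch `j` is the one whose downstream node is `j`.  The data are the series impedances,
tap ratios, shunt admittances `G j - i B j`, the fixed squared slack voltage `v0` and the known
net injections `p`, `q`. -/
structure RadialNetwork (J : ℕ) where
  /-- the upstream node of branch `j`; `none` is the slack node -/
  parent : Fin J → Option (Fin J)
  /-- the network is a tree rooted at the slack node: going upstream from any node ends there -/
  radial : ∀ j, ∃ n : ℕ, (fun o : Option (Fin J) => o.bind parent)^[n] (some j) = none
  r : Fin J → ℝ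
  x : Fin J → ℝ
  a : Fin J → ℝ
  a_ne_zero : ∀ j, a j ≠ 0
  G : Fin J → ℝ
  B : Fin J → ℝ
  v0 : ℝ
  v0_pos : 0 < v0
  p : Fin J → ℝ
  q : Fin J → ℝ

/-- The vector `u = (P, Q, l, v)` in `ℝ^{4J}` with the Euclidean norm. -/
abbrev FlowVec (J : ℕ) := EuclideanSpace ℝ (Fin 4 × Fin J)

/-- The space `ℝ^{3J}` of the mismatches in the linear equations. -/
abbrev ResVec (J : ℕ) := EuclideanSpace ℝ (Fin 3 × Fin J)

namespace FlowVec

variable {J : ℕ}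

/-- real power flow of branch `j` (sending end) -/
def P (u : FlowVec J) (j : Fin J) : ℝ := u (0, j)
/-- reactive power flow of branch `j` (sending end) -/
def Q (u : FlowVec J) (j : Fin J) : ℝ := u (1, j)
/-- squared current magnitude of branch `j` -/
def l (u : FlowVec J) (j : Fin J) : ℝ := u (2, j)
/-- squared voltage magnitude of node `j` -/
def v (u : FlowVec J) (j : Fin J) : ℝ := u (3, j)

/-- assemble `(P, Q, l, v)` -/
def mk (P Q l v : Fin J → ℝ) : FlowVec J :=
  WithLp.toLp 2 fun ij => (![P, Q, l, v] : Fin 4 → Fin J → ℝ) ij.1 ij.2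

end FlowVec

/-- The two retractions. -/
inductive QERetraction where
  | first
  | second

namespace RadialNetwork

variable {J : ℕ} (N : RadialNetwork J)

/-- The squared voltage `v_i` at the upstream node `i` of branch `j`. -/
def vUp (u : FlowVec J) (j : Fin J) : ℝ :=
  match N.parent j with
  | none => N.v0
  | some i => u.v i

/-- The branches whose upstream node is `j`. -/
def children (j : Fin J) : Finset (Fin J) :=
  Finset.univ.filter fun j' => N.parent j' = some j

/-- The part of `v_i / a_j²` that depends on the variables (the slack voltage is a parameter). -/
def vUpLin (u : FlowVec J) (j : Fin J) : ℝ :=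
  match N.parent j with
  | none => 0
  | some i => u.v i

/-- The rows of `A u`: real power balance, reactive power balance, voltage drop. -/
def linRow (u : FlowVec J) : Fin 3 → Fin J → ℝ :=
  ![fun j => (∑ j' ∈ N.children j, u.P j') - u.P j + N.a j ^ 2 * N.r j * u.l j + N.G j * u.v j,
    fun j => (∑ j' ∈ N.children j, u.Q j') - u.Q j + N.a j ^ 2 * N.x j * u.l j - N.B j * u.v j,
    fun j => u.v j - N.vUpLin u j / N.a j ^ 2 + 2 * (N.r j * u.P j + N.x j * u.Q j)
      - N.a j ^ 2 * (N.r j ^ 2 + N.x j ^ 2) * u.l j]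

/-- The `3J × 4J` matrix `A`, as a linear map. -/
def linMap : FlowVec J →ₗ[ℝ] ResVec J where
  toFun u := WithLp.toLp 2 fun ij => N.linRow u ij.1 ij.2
  map_add' u w := by
    ext ⟨i, j⟩
    have h : N.vUpLin (u + w) j = N.vUpLin u j + N.vUpLin w j := by
      unfold vUpLin; split <;> simp [FlowVec.v]
    fin_cases i <;>
      simp [linRow, h, FlowVec.P, FlowVec.Q, FlowVec.l, FlowVec.v, Finset.sum_add_distrib] <;> ring
  map_smul' c u := by
    ext ⟨i, j⟩
    have h : N.vUpLin (c • u) j = c * N.vUpLin u j := by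
      unfold vUpLin; split <;> simp [FlowVec.v]
    fin_cases i <;>
      simp [linRow, h, FlowVec.P, FlowVec.Q, FlowVec.l, FlowVec.v, ← Finset.mul_sum] <;> ring

/-- `A` as a continuous linear map. -/
def A : FlowVec J →L[ℝ] ResVec J := N.linMap.toContinuousLinearMap

/-- The right-hand side `b`: the known injections, and the slack voltage in the voltage drop
equation of the branches that start at the slack node. -/
def b : ResVec J :=
  WithLp.toLp 2 fun ij =>
    (![N.p, N.q,
      fun j => match N.parent j with
        | none => N.v0 / N.a j ^ 2
        | some _ => 0] : Fin 3 → Fin J → ℝ) ij.1 ij.2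

/-- `F_QE(u)_j = v_i l_j - P_j² - Q_j²`. -/
def F (u : FlowVec J) : EuclideanSpace ℝ (Fin J) :=
  WithLp.toLp 2 fun j => N.vUp u j * u.l j - (u.P j ^ 2 + u.Q j ^ 2)

/-- The QE manifold: the points with `F_QE(u) = 0` whose squared voltages `v_i` at the
upstream nodes of the branches are positive.  (At a point with some `v_i = 0` the differential
of `F_QE` may drop rank.) -/
def MQE : Set (FlowVec J) := {u | N.F u = 0 ∧ ∀ j, 0 < N.vUp u j}

/-- The differential of `F_QE`. -/
def DF (u : FlowVec J) : FlowVec J →L[ℝ] EuclideanSpace ℝ (Fin J) := fderiv ℝ N.F u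

/-- The orthogonal projection `Π_u = I - DFᵀ (DF DFᵀ)⁻¹ DF` onto the tangent space `ker DF(u)`. -/
def proj (u : FlowVec J) : FlowVec J →L[ℝ] FlowVec J :=
  ContinuousLinearMap.id ℝ (FlowVec J) -
    (ContinuousLinearMap.adjoint (N.DF u)).comp
      ((Ring.inverse ((N.DF u).comp (ContinuousLinearMap.adjoint (N.DF u)))).comp (N.DF u))

/-- The objective `f_QE(u) = ‖A u - b‖²`. -/
def f (u : FlowVec J) : ℝ := ‖N.A u - N.b‖ ^ 2

/-- The Riemannian gradient: the projection of the Euclidean gradient. -/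
def grad (u : FlowVec J) : FlowVec J := N.proj u (gradient N.f u)

/-- The Riemannian Hessian `ξ ↦ Π_u (D grad f(u)[ξ])`. -/
def hess (u : FlowVec J) : FlowVec J →L[ℝ] FlowVec J :=
  (N.proj u).comp (fderiv ℝ N.grad u)

/-- The derivative of the projection field applied to the frozen vector `2 Aᵀ (A u - b)`,
i.e. the matrix whose `n`-th column is `(∂Π/∂u_n) 2 Aᵀ (A u - b)`. -/
def projDeriv (u : FlowVec J) : FlowVec J →L[ℝ] FlowVec J :=
  fderiv ℝ (fun w => N.proj w
    ((2 : ℝ) • ContinuousLinearMap.adjoint N.A (N.A u - N.b))) u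

/-- The Hessian perturbation `E_u`. -/
def hessError (u : FlowVec J) : FlowVec J →L[ℝ] FlowVec J :=
  -(N.proj u).comp (N.projDeriv u)

/-- `ζ` solves the linear system `ζ ∈ T_u M_QE`, `A (u + ζ) = b`. -/
def IsDirection (u ζ : FlowVec J) : Prop := N.DF u ζ = 0 ∧ N.A (u + ζ) = N.b

/-- The rows of the (square) coefficient matrix of that linear system are linearly independent,
i.e. `ζ ↦ (DF(u) ζ, A ζ)` is onto `ℝ^J × ℝ^{3J}`. -/
def RowsIndep (u : FlowVec J) : Prop := Function.Surjective ((N.DF u).prod N.A)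

/-- `D = √(4 P² + 4 Q² + (l - v_i)²)` at branch `j`. -/
def D (w : FlowVec J) (j : Fin J) : ℝ :=
  Real.sqrt (4 * w.P j ^ 2 + 4 * w.Q j ^ 2 + (w.l j - N.vUp w j) ^ 2)

/-- The retracted point `R_u(ζ)` as a function of `w = u + ζ`. -/
def retract (ρ : QERetraction) (w : FlowVec J) : FlowVec J :=
  match ρ with
  | .first => FlowVec.mk
      (fun j => 2 * w.P j * N.vUp w j / (N.D w j - w.l j + N.vUp w j))
      (fun j => 2 * w.Q j * N.vUp w j / (N.D w j - w.l j + N.vUp w j))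
      (fun j => (N.D w j + w.l j - N.vUp w j) / (N.D w j - w.l j + N.vUp w j) * N.vUp w j)
      w.v
  | .second => FlowVec.mk w.P w.Q (fun j => (w.P j ^ 2 + w.Q j ^ 2) / N.vUp w j) w.v

/-- The points `w = u + ζ` at which the retraction is defined: the upstream squared voltages are
positive and no denominator vanishes. -/
def RetractDefined (ρ : QERetraction) (w : FlowVec J) : Prop :=
  (∀ j, 0 < N.vUp w j) ∧
    match ρ with
    | .first => ∀ j, N.D w j - w.l j + N.vUp w j ≠ 0
    | .second => True

/-- Armijo's condition for the stepsize `t`. -/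
def ArmijoCond (ρ : QERetraction) (σ : ℝ) (u ζ : FlowVec J) (t : ℝ) : Prop :=
  N.RetractDefined ρ (u + t • ζ) ∧
    N.f u - N.f (N.retract ρ (u + t • ζ)) ≥ -(σ * inner ℝ (N.grad u) (t • ζ))

/-- Armijo's rule: `t = β^m ᾱ` for the smallest `m` that satisfies Armijo's condition. -/
def ArmijoStep (ρ : QERetraction) (α β σ : ℝ) (u ζ : FlowVec J) (t : ℝ) : Prop :=
  ∃ m : ℕ, IsLeast {m : ℕ | N.ArmijoCond ρ σ u ζ (β ^ m * α)} m ∧ t = β ^ m * α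

/-- The rule that always takes the full step `t = 1`. -/
def UnitStep (ρ : QERetraction) (u ζ : FlowVec J) (t : ℝ) : Prop :=
  N.RetractDefined ρ (u + t • ζ) ∧ t = 1

/-- `s` is a sequence of iterates of the method with tolerance `ε` and the given stepsize rule.
Once the stopping test is met, the sequence stays where it is. -/
def IsRun (ρ : QERetraction) (rule : FlowVec J → FlowVec J → ℝ → Prop) (ε : ℝ)
    (s : ℕ → FlowVec J) : Prop :=
  s 0 ∈ N.MQE ∧ ∀ k,
    (ε < ‖N.grad (s k)‖ → ∃ ζ t, N.IsDirection (s k) ζ ∧ rule (s k) ζ t ∧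
      s (k + 1) = N.retract ρ (s k + t • ζ)) ∧
    (‖N.grad (s k)‖ ≤ ε → s (k + 1) = s k)

/-- From all starting points on the manifold near `z` the method can be run, and all its
sequences of iterates converge superlinearly to `z`. -/
def LocallySuperlinear (ρ : QERetraction) (rule : FlowVec J → FlowVec J → ℝ → Prop)
    (z : FlowVec J) : Prop :=
  ∃ U ∈ nhds z, ∀ u ∈ U ∩ N.MQE,
    (∃ s, N.IsRun ρ rule 0 s ∧ s 0 = u) ∧
    ∀ s, N.IsRun ρ rule 0 s → s 0 = u →
      Filter.Tendsto s Filter.atTop (nhds z) ∧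
      (fun k => s (k + 1) - z) =o[Filter.atTop] (fun k => s k - z)

end RadialNetwork

end

open Filter Topology

namespace RadialNetwork

variable {J : ℕ} (N : RadialNetwork J)

/-! Write r = ‖A u - b‖. Two exact identities drive everything. First, F is a quadratic polynomial,
so F(u + x) = F(u) + DF(u) x + `quadF` x with ‖`quadF` x‖ ≤ 3J‖x‖². Second, a direction ζ satisfies
A ζ = -(A u - b), hence ⟨grad f, ζ⟩ = -2r² and Π 2AᵀA ζ = -grad f. In the product rule for D grad f,
the term that differentiates Π is exactly what E_u removes, which leaves the Newton equation.

At a regular point the square system (DF(u), A) is invertible with locally uniform bounds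
(`RowsIndep.eventually_bound`). Thus ‖ζ‖ ≤ C r, and pairing ζ with grad f gives r ≤ (C/2)‖grad f‖.
As E_u is linear in the residual, it is O(‖grad f‖).

Each retraction moves w by a locally bounded multiple of F(w), and F(u + tζ) = `quadF` (tζ); so
retraction agrees with addition up to O(t²‖ζ‖²). With ‖ζ‖ = O(r), the new residual is (1 - t)(A u -
b) + O(t² r²). To leading order Armijo's condition reads (1 - t)² + 2σt ≤ 1, that is t ≤ 2(1 - σ).
This yields small admissible steps, uniform near regular points, hence critical accumulation points;
near a solution it yields acceptance of t = 1 for σ < 1/2 and rejection of every t > 2(1 - σ).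

Near a regular solution z, u + ζ - z lies in ker A and DF(u) sends it to `quadF` (z - u). So full
steps contract quadratically, retraction error included. -/

theorem _root_.EuclideanSpace.norm_le_sum_abs {ι : Type*} [Fintype ι] (y : EuclideanSpace ℝ ι) :
    ‖y‖ ≤ ∑ i, |y i| := by
  rw [EuclideanSpace.norm_eq]
  refine Real.sqrt_le_iff.2 ⟨Finset.sum_nonneg fun i _ => abs_nonneg _, ?_⟩
  simpa using Finset.sum_sq_le_sq_sum_of_nonneg (s := Finset.univ) (f := fun i => |y i|)
    fun i _ => abs_nonneg _

theorem _root_.EuclideanSpace.abs_apply_le_norm {ι : Type*} [Fintype ι] (y : EuclideanSpace ℝ ι)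
    (i : ι) : |y i| ≤ ‖y‖ := by
  simpa using PiLp.norm_apply_le y i

/-! ### The constraint map as a quadratic polynomial -/

theorem vUp_add (u w : FlowVec J) (j : Fin J) :
    N.vUp (u + w) j = N.vUp u j + N.vUpLin w j := by
  unfold vUp vUpLin; split <;> simp [FlowVec.v]

theorem vUpLin_add (u w : FlowVec J) (j : Fin J) :
    N.vUpLin (u + w) j = N.vUpLin u j + N.vUpLin w j := by
  unfold vUpLin; split <;> simp [FlowVec.v]

theorem vUpLin_smul (c : ℝ) (u : FlowVec J) (j : Fin J) :
    N.vUpLin (c • u) j = c * N.vUpLin u j := by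
  unfold vUpLin; split <;> simp [FlowVec.v]

theorem abs_vUpLin_le (u : FlowVec J) (j : Fin J) : |N.vUpLin u j| ≤ ‖u‖ := by
  unfold vUpLin; split
  · simp
  · exact EuclideanSpace.abs_apply_le_norm u _

@[fun_prop]
theorem contDiff_vUp {n : WithTop ℕ∞} (j : Fin J) : ContDiff ℝ n fun u => N.vUp u j := by
  unfold vUp; split
  · exact contDiff_const
  · unfold FlowVec.v; fun_prop

theorem contDiff_F {n : WithTop ℕ∞} : ContDiff ℝ n N.F := by
  rw [contDiff_euclidean]
  intro j
  have := N.contDiff_vUp (n := n) j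
  simp only [F, FlowVec.P, FlowVec.Q, FlowVec.l]
  fun_prop

/-- The homogeneous quadratic part of `F`. -/
def quadF (x : FlowVec J) : EuclideanSpace ℝ (Fin J) :=
  WithLp.toLp 2 fun j => N.vUpLin x j * x.l j - (x.P j ^ 2 + x.Q j ^ 2)

/-- The explicit differential of `F`. -/
def linF (u : FlowVec J) : FlowVec J →ₗ[ℝ] EuclideanSpace ℝ (Fin J) where
  toFun x := WithLp.toLp 2 fun j =>
    N.vUp u j * x.l j + u.l j * N.vUpLin x j - 2 * (u.P j * x.P j + u.Q j * x.Q j)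
  map_add' x y := by
    ext j
    simp [vUpLin_add, FlowVec.P, FlowVec.Q, FlowVec.l]; ring
  map_smul' c x := by
    ext j
    simp [vUpLin_smul, FlowVec.P, FlowVec.Q, FlowVec.l]; ring

theorem F_add_eq (u x : FlowVec J) : N.F (u + x) = N.F u + N.linF u x + N.quadF x := by
  ext j
  simp [F, linF, quadF, vUp_add, FlowVec.P, FlowVec.Q, FlowVec.l]; ring

theorem norm_quadF_le (x : FlowVec J) : ‖N.quadF x‖ ≤ 3 * J * ‖x‖ ^ 2 := by
  refine (EuclideanSpace.norm_le_sum_abs _).trans ?_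
  have h : ∀ j ∈ Finset.univ, |N.quadF x j| ≤ 3 * ‖x‖ ^ 2 := fun j _ => by
    have hv := N.abs_vUpLin_le x j
    have hl : |x.l j| ≤ ‖x‖ := EuclideanSpace.abs_apply_le_norm x _
    have hP : |x.P j| ≤ ‖x‖ := EuclideanSpace.abs_apply_le_norm x _
    have hQ : |x.Q j| ≤ ‖x‖ := EuclideanSpace.abs_apply_le_norm x _
    have h1 : |N.vUpLin x j * x.l j| ≤ ‖x‖ * ‖x‖ := by rw [abs_mul]; gcongr
    have h2 : x.P j ^ 2 ≤ ‖x‖ ^ 2 := by rw [← sq_abs]; gcongr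
    have h3 : x.Q j ^ 2 ≤ ‖x‖ ^ 2 := by rw [← sq_abs]; gcongr
    have := abs_le.1 h1
    simp only [quadF]
    rw [abs_le]
    constructor <;> nlinarith [sq_nonneg (x.P j), sq_nonneg (x.Q j)]
  refine (Finset.sum_le_sum h).trans (le_of_eq ?_)
  simp; ring

theorem DF_apply_eq (u x : FlowVec J) : N.DF u x = N.linF u x := by
  suffices h : HasFDerivAt N.F (N.linF u).toContinuousLinearMap u by
    rw [DF, h.fderiv]; rfl
  rw [hasFDerivAt_iff_isLittleO_nhds_zero]
  have h1 : (fun x => N.F (u + x) - N.F u - (N.linF u).toContinuousLinearMap x)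
      =O[𝓝 0] fun x => ‖x‖ ^ 2 := by
    refine Asymptotics.IsBigO.of_bound (3 * J) (Eventually.of_forall fun x => ?_)
    have h : N.F (u + x) - N.F u - (N.linF u).toContinuousLinearMap x = N.quadF x := by
      rw [F_add_eq, LinearMap.coe_toContinuousLinearMap']
      abel
    rw [h, Real.norm_of_nonneg (by positivity)]
    exact N.norm_quadF_le x
  refine h1.trans_isLittleO ?_
  exact Asymptotics.isLittleO_norm_pow_id (by norm_num)

theorem F_add (u x : FlowVec J) : N.F (u + x) = N.F u + N.DF u x + N.quadF x := by
  rw [F_add_eq, DF_apply_eq]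

theorem contDiff_DF {n : WithTop ℕ∞} : ContDiff ℝ n N.DF :=
  (N.contDiff_F (n := n + 1)).fderiv_right le_rfl

/-- The variable l_j occurs only in row j, with coefficient v_i > 0, so varying l alone already
reaches every value. This is where positive voltages make the manifold regular. -/
theorem DF_surjective {u : FlowVec J} (hu : ∀ j, 0 < N.vUp u j) :
    Function.Surjective (N.DF u) := by
  intro y
  refine ⟨FlowVec.mk 0 0 (fun j => y j / N.vUp u j) 0, ?_⟩
  rw [DF_apply_eq]
  ext j
  have h0 : N.vUpLin (FlowVec.mk 0 0 (fun j => y j / N.vUp u j) 0) j = 0 := by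
    unfold vUpLin; split <;> simp [FlowVec.mk, FlowVec.v]
  simp only [linF, LinearMap.coe_mk, AddHom.coe_mk, h0]
  simp [FlowVec.mk, FlowVec.P, FlowVec.Q, FlowVec.l, mul_div_cancel₀, (hu j).ne']

theorem eventually_vUp_pos {z : FlowVec J} (hz : ∀ j, 0 < N.vUp z j) :
    ∀ᶠ w in 𝓝 z, ∀ j, 0 < N.vUp w j :=
  eventually_all.2 fun j =>
    (N.contDiff_vUp (n := 0) j).continuous.continuousAt.eventually (lt_mem_nhds (hz j))

/-! ### The tangent projection and its smoothness -/

open ContinuousLinearMap (adjoint adjoint_inner_left adjoint_inner_right)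

/-- If T Tᵀ y = 0 then ‖Tᵀ y‖² = 0; writing y = T x gives ‖y‖² = ⟨x, Tᵀ y⟩ = 0. Injectivity suffices
in finite dimension. -/
theorem _root_.ContinuousLinearMap.isUnit_comp_adjoint {E W : Type*}
    [NormedAddCommGroup E] [InnerProductSpace ℝ E] [CompleteSpace E]
    [NormedAddCommGroup W] [InnerProductSpace ℝ W] [FiniteDimensional ℝ W] [CompleteSpace W]
    {T : E →L[ℝ] W} (hT : Function.Surjective T) : IsUnit (T.comp (adjoint T)) := by
  have hinj : Function.Injective (T.comp (adjoint T)) := by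
    rw [injective_iff_map_eq_zero]
    intro y hy
    have h1 : adjoint T y = 0 := by
      rw [← inner_self_eq_zero (𝕜 := ℝ), adjoint_inner_left]
      change inner ℝ y (T.comp (adjoint T) y) = 0
      rw [hy, inner_zero_right]
    obtain ⟨x, rfl⟩ := hT y
    rw [← inner_self_eq_zero (𝕜 := ℝ), ← adjoint_inner_left, h1, inner_zero_left]
  rw [ContinuousLinearMap.isUnit_iff_bijective]
  exact ⟨hinj, LinearMap.surjective_of_injective (f := (T.comp (adjoint T)).toLinearMap) hinj⟩

theorem proj_apply (u x : FlowVec J) : N.proj u x = x - adjoint (N.DF u)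
    (Ring.inverse ((N.DF u).comp (adjoint (N.DF u))) (N.DF u x)) := rfl

theorem proj_of_tangent {u x : FlowVec J} (hx : N.DF u x = 0) : N.proj u x = x := by
  simp [proj_apply, hx]

/-- The part that Π removes lies in the range of DFᵀ, which is orthogonal to ker DF. This holds
whatever value `Ring.inverse` takes, so no rank condition is needed. -/
theorem inner_proj_of_tangent {u x : FlowVec J} (y : FlowVec J) (hx : N.DF u x = 0) :
    inner ℝ (N.proj u y) x = inner ℝ y x := by
  rw [proj_apply, inner_sub_left, adjoint_inner_left, hx, inner_zero_right, sub_zero]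

theorem DF_proj {u : FlowVec J} (hu : ∀ j, 0 < N.vUp u j) (x : FlowVec J) :
    N.DF u (N.proj u x) = 0 := by
  have h := Ring.mul_inverse_cancel _ (ContinuousLinearMap.isUnit_comp_adjoint (N.DF_surjective hu))
  have h' := congrArg (fun T => T (N.DF u x)) h
  rw [proj_apply, map_sub, sub_eq_zero]
  exact h'.symm

theorem proj_proj {u : FlowVec J} (hu : ∀ j, 0 < N.vUp u j) (x : FlowVec J) :
    N.proj u (N.proj u x) = N.proj u x :=
  N.proj_of_tangent (N.DF_proj hu x)

theorem _root_.ContinuousLinearMap.contDiff_adjoint {E W : Type*}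
    [NormedAddCommGroup E] [InnerProductSpace ℝ E] [FiniteDimensional ℝ E] [CompleteSpace E]
    [NormedAddCommGroup W] [InnerProductSpace ℝ W] [FiniteDimensional ℝ W] [CompleteSpace W]
    {n : WithTop ℕ∞} : ContDiff ℝ n fun T : E →L[ℝ] W => adjoint T := by
  let f : (E →L[ℝ] W) →ₗ[ℝ] (W →L[ℝ] E) :=
    { toFun := fun T => adjoint T
      map_add' := map_add _
      map_smul' := fun c T => by simp }
  exact f.toContinuousLinearMap.contDiff

theorem contDiffAt_proj {n : WithTop ℕ∞} {u : FlowVec J} (hu : ∀ j, 0 < N.vUp u j) :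
    ContDiffAt ℝ n N.proj u := by
  have hD : ContDiffAt ℝ n N.DF u := N.contDiff_DF.contDiffAt
  have hA : ContDiffAt ℝ n (fun w => adjoint (N.DF w)) u :=
    ContinuousLinearMap.contDiff_adjoint.contDiffAt.comp u hD
  obtain ⟨T, hT⟩ := ContinuousLinearMap.isUnit_comp_adjoint (N.DF_surjective hu)
  have hI : ContDiffAt ℝ n (fun w => Ring.inverse ((N.DF w).comp (adjoint (N.DF w)))) u := by
    have h := contDiffAt_ringInverse ℝ (n := n) T
    rw [hT] at h
    exact ContDiffAt.comp u h (hD.clm_comp hA)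
  exact contDiffAt_const.sub (hA.clm_comp (hI.clm_comp hD))

/-! ### Gradient, Hessian and the perturbed Newton equation -/

theorem gradient_f (u : FlowVec J) :
    gradient N.f u = (2 : ℝ) • adjoint N.A (N.A u - N.b) := by
  refine HasGradientAt.gradient ?_
  rw [hasGradientAt_iff_hasFDerivAt]
  have h := ((N.A.hasFDerivAt (x := u)).sub_const N.b).norm_sq
  refine h.congr_fderiv ?_
  ext x
  simp [adjoint_inner_left]

theorem grad_eq (u : FlowVec J) :
    N.grad u = N.proj u ((2 : ℝ) • adjoint N.A (N.A u - N.b)) := by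
  rw [grad, gradient_f]

theorem projDeriv_apply {u : FlowVec J} (hu : ∀ j, 0 < N.vUp u j) (x : FlowVec J) :
    N.projDeriv u x = fderiv ℝ N.proj u x ((2 : ℝ) • adjoint N.A (N.A u - N.b)) := by
  have h := ((N.contDiffAt_proj (n := 1) hu).differentiableAt one_ne_zero).hasFDerivAt.clm_apply
    (hasFDerivAt_const ((2 : ℝ) • adjoint N.A (N.A u - N.b)) u)
  rw [projDeriv, h.fderiv]
  simp

theorem _root_.fderiv_clm_apply_sub_apply {E G : Type*} [NormedAddCommGroup E] [NormedSpace ℝ E]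
    [NormedAddCommGroup G] [NormedSpace ℝ G] {p : E → E →L[ℝ] G} {u : E}
    (hp : DifferentiableAt ℝ p u) (T : E →L[ℝ] E) (c x : E) :
    fderiv ℝ (fun w => p w (T w - c)) u x = fderiv ℝ p u x (T u - c) + p u (T x) := by
  have h := hp.hasFDerivAt.clm_apply ((T.hasFDerivAt (x := u)).sub_const c)
  rw [h.fderiv]
  simp [add_comm]

/-- Product rule for Π_w applied to the affine field 2Aᵀ(A w - b): the first term freezes the
vector, the second freezes Π. -/
theorem fderiv_grad_apply {u : FlowVec J} (hu : ∀ j, 0 < N.vUp u j) (x : FlowVec J) :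
    fderiv ℝ N.grad u x =
      N.projDeriv u x + N.proj u ((2 : ℝ) • adjoint N.A (N.A x)) := by
  have hg : ∀ w, (2 : ℝ) • adjoint N.A (N.A w - N.b) =
      ((2 : ℝ) • (adjoint N.A).comp N.A) w - (2 : ℝ) • adjoint N.A N.b := fun w => by
    rw [map_sub, smul_sub]; rfl
  have hgrad : N.grad = fun w =>
      N.proj w (((2 : ℝ) • (adjoint N.A).comp N.A) w - (2 : ℝ) • adjoint N.A N.b) :=
    funext fun w => by rw [← hg, grad_eq]
  rw [projDeriv_apply N hu, hgrad, hg, fderiv_clm_apply_sub_apply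
    ((N.contDiffAt_proj (n := 1) hu).differentiableAt one_ne_zero)]
  rfl

theorem IsDirection.A_apply {N : RadialNetwork J} {u ζ : FlowVec J} (h : N.IsDirection u ζ) :
    N.A ζ = -(N.A u - N.b) := by
  have := h.2
  rw [map_add] at this
  rw [← this]; abel

/-- E_u cancels the projected derivative of Π; by idempotence Π 2AᵀA ζ is left, and A ζ = -(A u - b)
turns it into -grad f. -/
theorem hess_add_hessError_apply {u ζ : FlowVec J} (hu : ∀ j, 0 < N.vUp u j)
    (h : N.IsDirection u ζ) : (N.hess u + N.hessError u) ζ = -N.grad u := by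
  simp only [hess, hessError, add_apply, neg_apply,
    ContinuousLinearMap.comp_apply, N.fderiv_grad_apply hu, map_add, N.proj_proj hu]
  rw [h.A_apply, grad_eq, map_neg, smul_neg, map_neg]
  abel

theorem inner_grad_direction {u ζ : FlowVec J} (h : N.IsDirection u ζ) :
    inner ℝ (N.grad u) ζ = -(2 * ‖N.A u - N.b‖ ^ 2) := by
  rw [grad_eq, N.inner_proj_of_tangent _ h.1, inner_smul_left, adjoint_inner_left, h.A_apply,
    inner_neg_right, real_inner_self_eq_norm_sq]
  simp

theorem grad_eq_zero_of_residual {u : FlowVec J} (h : N.A u = N.b) : N.grad u = 0 := by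
  simp [grad_eq, h]

/-! ### Uniform bounds near regular points -/

/-- Near a regular point the linear system for the direction is uniformly solvable. -/
theorem RowsIndep.eventually_bound {N : RadialNetwork J} {z : FlowVec J} (hz : N.RowsIndep z) :
    ∃ C : ℝ, 0 < C ∧ ∀ᶠ u in 𝓝 z,
      (∀ x, ‖x‖ ≤ C * ‖((N.DF u).prod N.A) x‖) ∧ Function.Surjective ((N.DF u).prod N.A) := by
  have hdim : Module.finrank ℝ (FlowVec J) =
      Module.finrank ℝ (EuclideanSpace ℝ (Fin J) × ResVec J) := by
    simp; ring
  have hinj : Function.Injective ((N.DF z).prod N.A) :=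
    (LinearMap.injective_iff_surjective_of_finrank_eq_finrank
      (f := ((N.DF z).prod N.A).toLinearMap) hdim).2 hz
  obtain ⟨K, hK, hKz⟩ := ((N.DF z).prod N.A).toLinearMap.exists_antilipschitzWith
    (LinearMap.ker_eq_bot.2 hinj)
  have hKz' : ∀ x, ‖x‖ ≤ K * ‖((N.DF z).prod N.A) x‖ := fun x => by
    have := hKz.le_mul_dist x 0
    rwa [map_zero, dist_zero_right, dist_zero_right] at this
  have hK' : (0 : ℝ) < K := hK
  have hcont : Continuous fun u => (N.DF u).prod N.A := by
    have h1 : Continuous N.DF := (N.contDiff_DF (n := 0)).continuous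
    have h2 := (ContinuousLinearMap.prodₗᵢ (𝕜 := ℝ) (E := FlowVec J)
      (F := EuclideanSpace ℝ (Fin J)) (G := ResVec J) ℝ).continuous
    exact h2.comp (h1.prodMk continuous_const)
  -- A perturbation of operator norm below 1/(2K) costs at most ‖x‖/2 in the bound with K, which
  -- doubles the constant.
  refine ⟨2 * K, by positivity, ?_⟩
  filter_upwards [Metric.continuousAt_iff'.1 hcont.continuousAt (1 / (2 * K)) (by positivity)]
    with u hu
  have hb : ∀ x, ‖x‖ ≤ 2 * K * ‖((N.DF u).prod N.A) x‖ := fun x => by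
    rw [dist_eq_norm] at hu
    have h1 : ‖((N.DF u).prod N.A) x - ((N.DF z).prod N.A) x‖ ≤ 1 / (2 * K) * ‖x‖ :=
      (((N.DF u).prod N.A - (N.DF z).prod N.A).le_opNorm x).trans (by gcongr)
    have h2 : ‖((N.DF z).prod N.A) x‖ ≤ ‖((N.DF u).prod N.A) x‖ + 1 / (2 * K) * ‖x‖ := by
      have := norm_sub_norm_le (((N.DF z).prod N.A) x) (((N.DF u).prod N.A) x)
      rw [norm_sub_rev] at this
      linarith
    have h3 := (hKz' x).trans (mul_le_mul_of_nonneg_left h2 hK'.le)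
    have h4 : (K : ℝ) * (1 / (2 * K) * ‖x‖) = ‖x‖ / 2 := by field_simp
    rw [mul_add, h4] at h3
    linarith
  refine ⟨hb, ?_⟩
  have hinj' : Function.Injective ((N.DF u).prod N.A) := by
    rw [injective_iff_map_eq_zero]
    intro x hx
    have := hb x
    rw [hx, norm_zero, mul_zero] at this
    exact norm_le_zero_iff.1 this
  exact (LinearMap.injective_iff_surjective_of_finrank_eq_finrank
      (f := ((N.DF u).prod N.A).toLinearMap) hdim).1 hinj'

theorem exists_direction {u : FlowVec J} (h : Function.Surjective ((N.DF u).prod N.A)) :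
    ∃ ζ, N.IsDirection u ζ := by
  obtain ⟨ζ, hζ⟩ := h (0, N.b - N.A u)
  have h1 : N.DF u ζ = 0 := congrArg Prod.fst hζ
  have h2 : N.A ζ = N.b - N.A u := congrArg Prod.snd hζ
  exact ⟨ζ, h1, by rw [map_add, h2]; abel⟩

theorem IsDirection.norm_le {N : RadialNetwork J} {u ζ : FlowVec J} {C : ℝ}
    (hC : ∀ x, ‖x‖ ≤ C * ‖((N.DF u).prod N.A) x‖) (h : N.IsDirection u ζ) :
    ‖ζ‖ ≤ C * ‖N.A u - N.b‖ := by
  have := hC ζ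
  rwa [ContinuousLinearMap.prod_apply, h.1, h.A_apply, Prod.norm_def, norm_zero, norm_neg,
    max_eq_right (norm_nonneg _)] at this

/-- Cauchy–Schwarz applied to ⟨grad f, ζ⟩ = -2r² with ‖ζ‖ ≤ C r gives 2r² ≤ C r ‖grad f‖; divide by
r. -/
theorem norm_residual_le {u : FlowVec J} {C : ℝ}
    (hC : ∀ x, ‖x‖ ≤ C * ‖((N.DF u).prod N.A) x‖)
    (hs : Function.Surjective ((N.DF u).prod N.A)) :
    ‖N.A u - N.b‖ ≤ C / 2 * ‖N.grad u‖ := by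
  obtain ⟨ζ, hζ⟩ := N.exists_direction hs
  have h1 := hζ.norm_le hC
  have h2 := abs_real_inner_le_norm (N.grad u) ζ
  rw [N.inner_grad_direction hζ, abs_neg, abs_of_nonneg (by positivity)] at h2
  rcases (norm_nonneg (N.A u - N.b)).eq_or_lt with h0 | h0
  · have hCn : 0 ≤ C * ‖N.A u - N.b‖ := (norm_nonneg _).trans h1
    rw [← h0]
    -- The sign of C is not given. A nonzero vector forces C > 0 through `hC`; if the gradient
    -- vanishes there is nothing to show.
    by_cases hg : N.grad u = 0
    · simp [hg]
    · have := hC (N.grad u)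
      have h3 : 0 < C := by
        by_contra! hneg
        have h4 : C * ‖((N.DF u).prod N.A) (N.grad u)‖ ≤ 0 :=
          mul_nonpos_of_nonpos_of_nonneg hneg (norm_nonneg _)
        exact hg (norm_le_zero_iff.1 (this.trans h4))
      positivity
  · have h3 : 2 * ‖N.A u - N.b‖ ^ 2 ≤ ‖N.grad u‖ * (C * ‖N.A u - N.b‖) :=
      h2.trans (by gcongr)
    nlinarith

/-- E_u is linear in the residual, with coefficients Π and DΠ that are continuous and hence bounded
near z. -/
theorem eventually_norm_hessError_le {z : FlowVec J} (hz : ∀ j, 0 < N.vUp z j) :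
    ∃ C : ℝ, 0 ≤ C ∧ ∀ᶠ u in 𝓝 z, ‖N.hessError u‖ ≤ C * ‖N.A u - N.b‖ := by
  have h1 : ContinuousAt N.proj z := (N.contDiffAt_proj (n := 0) hz).continuousAt
  have h2 : ContDiffAt ℝ 0 (fderiv ℝ N.proj) z :=
    (N.contDiffAt_proj (n := 1) hz).fderiv_right (by simp)
  have e1 := h1.norm.eventually (gt_mem_nhds (lt_add_one _))
  have h2' : ContinuousAt (fun u => ‖fderiv ℝ N.proj u‖) z :=
    ContinuousAt.norm (E := FlowVec J →L[ℝ] FlowVec J →L[ℝ] FlowVec J) h2.continuousAt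
  have e2 := h2'.eventually (gt_mem_nhds (lt_add_one _))
  set a := ‖N.proj z‖ + 1
  set c := ‖fderiv ℝ N.proj z‖ + 1
  have ha : 0 ≤ a := by positivity
  have hc : 0 ≤ c := by positivity
  refine ⟨a * (c * (2 * ‖adjoint N.A‖)), by positivity, ?_⟩
  filter_upwards [e1, e2, N.eventually_vUp_pos hz] with u hu1 hu2 hu
  rw [hessError, norm_neg]
  refine ContinuousLinearMap.opNorm_le_bound _ (by positivity) fun x => ?_
  rw [ContinuousLinearMap.comp_apply, projDeriv_apply N hu]
  have hg : ‖(2 : ℝ) • adjoint N.A (N.A u - N.b)‖ ≤ 2 * (‖adjoint N.A‖ * ‖N.A u - N.b‖) := by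
    rw [norm_smul, Real.norm_two]
    gcongr
    exact (adjoint N.A).le_opNorm _
  calc _ ≤ a * (c * ‖x‖ * (2 * (‖adjoint N.A‖ * ‖N.A u - N.b‖))) := by
        refine (N.proj u).le_of_opNorm_le_of_le hu1.le ?_
        refine ContinuousLinearMap.le_of_opNorm_le_of_le _ ?_ hg
        exact (fderiv ℝ N.proj u).le_of_opNorm_le hu2.le x
    _ = _ := by ring

theorem exists_hessError_bound {K : Set (FlowVec J)} (hKM : K ⊆ N.MQE) (hK : IsCompact K)
    (hreg : ∀ u ∈ K, N.RowsIndep u) :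
    ∃ γ : ℝ, ∀ u ∈ K, ‖N.hessError u‖ ≤ γ * ‖N.grad u‖ := by
  refine hK.induction_on (p := fun S => ∃ γ : ℝ, ∀ u ∈ S, ‖N.hessError u‖ ≤ γ * ‖N.grad u‖)
    ⟨0, by simp⟩ (fun S T hST ⟨γ, h⟩ => ⟨γ, fun u hu => h u (hST hu)⟩) ?_ ?_
  · rintro S T ⟨γ, hS⟩ ⟨δ, hT⟩
    refine ⟨max γ δ, ?_⟩
    rintro u (hu | hu)
    · exact (hS u hu).trans (by gcongr; exact le_max_left _ _)
    · exact (hT u hu).trans (by gcongr; exact le_max_right _ _)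
  · intro z hz
    obtain ⟨C, hC, hb⟩ := (hreg z hz).eventually_bound
    obtain ⟨c, hc, he⟩ := N.eventually_norm_hessError_le (hKM hz).2
    refine ⟨_, mem_nhdsWithin_of_mem_nhds (hb.and he), c * (C / 2), ?_⟩
    rintro u ⟨⟨h1, h2⟩, h3⟩
    refine h3.trans ?_
    rw [mul_assoc]
    gcongr
    exact N.norm_residual_le h1 h2

end RadialNetwork

/-! ### The retractions to second order -/

open Filter Topology

namespace RadialNetwork

variable {J : ℕ} (N : RadialNetwork J)

theorem vUp_congr {u w : FlowVec J} (h : u.v = w.v) (j : Fin J) : N.vUp u j = N.vUp w j := by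
  unfold vUp; rw [h]

theorem retract_v (ρ : QERetraction) (w : FlowVec J) : (N.retract ρ w).v = w.v := by
  cases ρ <;> rfl

theorem F_apply_eq_zero_iff {u : FlowVec J} :
    N.F u = 0 ↔ ∀ j, N.vUp u j * u.l j = u.P j ^ 2 + u.Q j ^ 2 := by
  rw [PiLp.ext_iff]
  exact forall_congr' fun j => sub_eq_zero

theorem D_sq (w : FlowVec J) (j : Fin J) :
    N.D w j ^ 2 = 4 * w.P j ^ 2 + 4 * w.Q j ^ 2 + (w.l j - N.vUp w j) ^ 2 :=
  Real.sq_sqrt (by positivity)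

theorem retract_mem {ρ : QERetraction} {w : FlowVec J} (h : N.RetractDefined ρ w) :
    N.retract ρ w ∈ N.MQE := by
  have hv : ∀ j, N.vUp (N.retract ρ w) j = N.vUp w j := N.vUp_congr (N.retract_v ρ w)
  refine ⟨N.F_apply_eq_zero_iff.2 fun j => ?_, fun j => by rw [hv]; exact h.1 j⟩
  rw [hv]
  have hpos := (h.1 j).ne'
  cases ρ with
  | first =>
    have hs := h.2 j
    have hD := N.D_sq w j
    simp only [retract, FlowVec.mk, FlowVec.P, FlowVec.Q, FlowVec.l, Matrix.cons_val] at hs hD ⊢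
    field_simp
    linear_combination hD
  | second =>
    simp only [retract, FlowVec.mk, FlowVec.P, FlowVec.Q, FlowVec.l, Matrix.cons_val]
    field_simp

/-- On the manifold 4P² + 4Q² = 4 v_i l, so D² = (l + v_i)². The denominator D - l + v_i is
therefore 2v_i > 0 there. -/
theorem D_eq_of_mem {z : FlowVec J} (hz : z ∈ N.MQE) (j : Fin J) :
    N.D z j = z.l j + N.vUp z j ∧ 0 ≤ z.l j := by
  have h1 := N.F_apply_eq_zero_iff.1 hz.1 j
  have h2 := hz.2 j
  have h3 : 0 ≤ z.l j := by
    refine nonneg_of_mul_nonneg_right (a := N.vUp z j) ?_ h2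
    rw [h1]; positivity
  refine ⟨?_, h3⟩
  rw [D, show 4 * z.P j ^ 2 + 4 * z.Q j ^ 2 + (z.l j - N.vUp z j) ^ 2
    = (z.l j + N.vUp z j) ^ 2 by linear_combination -4 * h1]
  exact Real.sqrt_sq (by positivity)

/-- Each displacement contains the factor l + v_i - D. Multiplying by D + l + v_i rationalizes it,
because (l + v_i)² - D² = 4F_j. -/
theorem retract_first_sub {w : FlowVec J} {j : Fin J}
    (hs : N.D w j - w.l j + N.vUp w j ≠ 0) (ht : N.D w j + w.l j + N.vUp w j ≠ 0) (i : Fin 4) :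
    (N.retract .first w - w) (i, j) =
      (![4 * w.P j, 4 * w.Q j, 4 * (w.l j - N.vUp w j), 0] : Fin 4 → ℝ) i /
        ((N.D w j - w.l j + N.vUp w j) * (N.D w j + w.l j + N.vUp w j)) * N.F w j := by
  have hD := N.D_sq w j
  simp only [FlowVec.P, FlowVec.Q, FlowVec.l] at hs ht hD
  fin_cases i
  · simp [retract, FlowVec.mk, FlowVec.P, FlowVec.Q, FlowVec.l, F]
    field_simp
    linear_combination -w (0, j) * hD
  · simp [retract, FlowVec.mk, FlowVec.P, FlowVec.Q, FlowVec.l, F]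
    field_simp
    linear_combination -w (1, j) * hD
  · simp [retract, FlowVec.mk, FlowVec.P, FlowVec.Q, FlowVec.l, F]
    field_simp
    linear_combination -(w (2, j) - N.vUp w j) * hD
  · simp [retract, FlowVec.mk, FlowVec.v]

theorem retract_second_sub {w : FlowVec J} {j : Fin J} (hv : N.vUp w j ≠ 0) (i : Fin 4) :
    (N.retract .second w - w) (i, j) =
      (![0, 0, -1, 0] : Fin 4 → ℝ) i / N.vUp w j * N.F w j := by
  fin_cases i
  · simp [retract, FlowVec.mk, FlowVec.P]
  · simp [retract, FlowVec.mk, FlowVec.Q]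
  · simp [retract, FlowVec.mk, FlowVec.P, FlowVec.Q, FlowVec.l, F]
    field_simp
    ring
  · simp [retract, FlowVec.mk, FlowVec.v]

theorem _root_.ContinuousAt.eventually_abs_le {X : Type*} [TopologicalSpace X] {g : X → ℝ} {z : X}
    (hg : ContinuousAt g z) : ∀ᶠ w in 𝓝 z, |g w| ≤ |g z| + 1 :=
  (hg.abs.eventually (gt_mem_nhds (lt_add_one _))).mono fun _ h => le_of_lt h

/-- Near the manifold, the retraction moves a point by a multiple of its constraint violation. -/
theorem eventually_norm_retract_sub_le (ρ : QERetraction) {z : FlowVec J} (hz : z ∈ N.MQE) :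
    ∃ C : ℝ, 0 ≤ C ∧ ∀ᶠ w in 𝓝 z,
      N.RetractDefined ρ w ∧ ‖N.retract ρ w - w‖ ≤ C * ‖N.F w‖ := by
  suffices h : ∀ ij : Fin 4 × Fin J, ∃ K : ℝ, ∀ᶠ w in 𝓝 z,
      N.RetractDefined ρ w ∧ |(N.retract ρ w - w) ij| ≤ K * |N.F w ij.2| by
    choose K hK using h
    refine ⟨∑ ij, |K ij|, Finset.sum_nonneg fun _ _ => abs_nonneg _, ?_⟩
    -- For J = 0 there is no component from which to read off definedness, so this case is separate.
    have hdef : ∀ᶠ w in 𝓝 z, N.RetractDefined ρ w := by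
      rcases isEmpty_or_nonempty (Fin J) with hJ | ⟨⟨j⟩⟩
      · refine Eventually.of_forall fun w => ⟨fun j => isEmptyElim j, ?_⟩
        cases ρ
        · exact fun j => isEmptyElim j
        · trivial
      · exact (hK (0, j)).mono fun w hw => hw.1
    filter_upwards [eventually_all.2 hK, hdef] with w hw hd
    refine ⟨hd, (EuclideanSpace.norm_le_sum_abs _).trans ?_⟩
    rw [Finset.sum_mul]
    refine Finset.sum_le_sum fun ij _ => (hw ij).2.trans ?_
    gcongr
    · exact le_abs_self _
    · exact EuclideanSpace.abs_apply_le_norm _ _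
  rintro ⟨i, j⟩
  have hvp := N.eventually_vUp_pos hz.2
  have hv : ∀ j, ContinuousAt (fun w => N.vUp w j) z := fun j =>
    (N.contDiff_vUp (n := 0) j).continuous.continuousAt
  have hP : ∀ j, ContinuousAt (fun w : FlowVec J => w.P j) z := fun j => by
    unfold FlowVec.P; fun_prop
  have hQ : ∀ j, ContinuousAt (fun w : FlowVec J => w.Q j) z := fun j => by
    unfold FlowVec.Q; fun_prop
  have hl : ∀ j, ContinuousAt (fun w : FlowVec J => w.l j) z := fun j => by
    unfold FlowVec.l; fun_prop
  cases ρ with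
  | first =>
    have hD : ∀ j, ContinuousAt (fun w => N.D w j) z := fun j => by
      unfold D; fun_prop
    have hs : ∀ j, ContinuousAt (fun w => N.D w j - w.l j + N.vUp w j) z := fun j => by fun_prop
    have ht : ∀ j, ContinuousAt (fun w => N.D w j + w.l j + N.vUp w j) z := fun j => by fun_prop
    have hs0 : ∀ j, N.D z j - z.l j + N.vUp z j ≠ 0 := fun j => by
      have := hz.2 j
      rw [(N.D_eq_of_mem hz j).1]
      intro h; linarith
    have ht0 : ∀ j, N.D z j + z.l j + N.vUp z j ≠ 0 := fun j => by
      have := hz.2 j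
      have h' := N.D_eq_of_mem hz j
      rw [h'.1]
      intro h; linarith [h'.2]
    have hnum : ContinuousAt (fun w : FlowVec J =>
        (![4 * w.P j, 4 * w.Q j, 4 * (w.l j - N.vUp w j), 0] : Fin 4 → ℝ) i) z := by
      fin_cases i
      · exact continuousAt_const.mul (hP j)
      · exact continuousAt_const.mul (hQ j)
      · exact continuousAt_const.mul ((hl j).sub (hv j))
      · exact continuousAt_const
    obtain ⟨K, hb⟩ : ∃ K : ℝ, ∀ᶠ w in 𝓝 z,
        |(![4 * w.P j, 4 * w.Q j, 4 * (w.l j - N.vUp w j), 0] : Fin 4 → ℝ) i /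
          ((N.D w j - w.l j + N.vUp w j) * (N.D w j + w.l j + N.vUp w j))| ≤ K :=
      ⟨_, (hnum.div ((hs j).mul (ht j)) (mul_ne_zero (hs0 j) (ht0 j))).eventually_abs_le⟩
    refine ⟨K, ?_⟩
    filter_upwards [hb, hvp, eventually_all.2 fun j => (hs j).eventually_ne (hs0 j),
      (ht j).eventually_ne (ht0 j)] with w h1 h2 h3 h4
    refine ⟨⟨h2, h3⟩, ?_⟩
    rw [N.retract_first_sub (h3 j) h4, abs_mul]
    gcongr
  | second =>
    obtain ⟨K, hb⟩ : ∃ K : ℝ, ∀ᶠ w in 𝓝 z,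
        |(![0, 0, -1, 0] : Fin 4 → ℝ) i / N.vUp w j| ≤ K :=
      ⟨_, ((continuousAt_const (y := (![0, 0, -1, 0] : Fin 4 → ℝ) i)).div (hv j)
        (hz.2 j).ne').eventually_abs_le⟩
    refine ⟨K, ?_⟩
    filter_upwards [hb, hvp] with w h1 h2
    refine ⟨⟨h2, trivial⟩, ?_⟩
    rw [N.retract_second_sub (h2 j).ne', abs_mul]
    gcongr

/-- Near the manifold, the retraction agrees with addition up to second order. -/
theorem exists_retract_second_order (ρ : QERetraction) {z : FlowVec J} (hz : z ∈ N.MQE) :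
    ∃ C : ℝ, 0 ≤ C ∧ ∃ δ > 0, ∀ u ∈ N.MQE, ∀ x, N.DF u x = 0 → ‖u + x - z‖ < δ →
      N.RetractDefined ρ (u + x) ∧ ‖N.retract ρ (u + x) - (u + x)‖ ≤ C * ‖x‖ ^ 2 := by
  obtain ⟨C, hC, h⟩ := N.eventually_norm_retract_sub_le ρ hz
  obtain ⟨δ, hδ, h⟩ := Metric.eventually_nhds_iff.1 h
  refine ⟨C * (3 * J), by positivity, δ, hδ, fun u hu x hx hd => ?_⟩
  obtain ⟨h1, h2⟩ := h (y := u + x) (by rwa [dist_eq_norm])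
  refine ⟨h1, h2.trans ?_⟩
  rw [N.F_add, hu.1, hx, zero_add, zero_add, mul_assoc]
  gcongr
  exact N.norm_quadF_le x

end RadialNetwork

/-! ### Armijo's rule and descent -/

open Filter Topology

namespace RadialNetwork

variable {J : ℕ} {N : RadialNetwork J}

theorem f_eq_zero_iff {u : FlowVec J} : N.f u = 0 ↔ N.A u = N.b := by
  rw [f, sq_eq_zero_iff, norm_eq_zero, sub_eq_zero]

theorem continuous_f : Continuous N.f :=
  ((N.A.continuous.sub continuous_const).norm).pow 2

theorem f_pos_of_grad_ne_zero {u : FlowVec J} (h : N.grad u ≠ 0) : 0 < N.f u :=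
  lt_of_le_of_ne (sq_nonneg _) fun h0 =>
    h (N.grad_eq_zero_of_residual (f_eq_zero_iff.1 h0.symm))

/-- The residual after a retracted step along a direction, up to second order. -/
theorem norm_residual_retract_sub_le {ρ : QERetraction} {u ζ : FlowVec J} {t B C : ℝ}
    (hζ : N.IsDirection u ζ) (hC : 0 ≤ C) (hB : ‖ζ‖ ≤ B * ‖N.A u - N.b‖)
    (hR : ‖N.retract ρ (u + t • ζ) - (u + t • ζ)‖ ≤ C * ‖t • ζ‖ ^ 2) :
    ‖N.A (N.retract ρ (u + t • ζ)) - N.b - (1 - t) • (N.A u - N.b)‖ ≤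
      ‖N.A‖ * C * B ^ 2 * t ^ 2 * ‖N.A u - N.b‖ ^ 2 := by
  have h1 : N.A (N.retract ρ (u + t • ζ)) - N.b - (1 - t) • (N.A u - N.b) =
      N.A (N.retract ρ (u + t • ζ) - (u + t • ζ)) := by
    rw [map_sub, map_add, map_smul, hζ.A_apply]
    module
  rw [h1]
  have h2 : ‖t • ζ‖ ^ 2 ≤ t ^ 2 * (B * ‖N.A u - N.b‖) ^ 2 := by
    rw [norm_smul, mul_pow, Real.norm_eq_abs, sq_abs]
    gcongr
  calc _ ≤ ‖N.A‖ * (C * (t ^ 2 * (B * ‖N.A u - N.b‖) ^ 2)) :=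
        N.A.le_opNorm_of_le (hR.trans (by gcongr))
    _ = _ := by ring

theorem _root_.abs_norm_sq_sub_norm_sq_le {E : Type*} [NormedAddCommGroup E] {x y : E} {e : ℝ}
    (h : ‖x - y‖ ≤ e) : |‖x‖ ^ 2 - ‖y‖ ^ 2| ≤ 2 * ‖y‖ * e + e ^ 2 := by
  have h1 := abs_le.1 ((abs_norm_sub_norm_le x y).trans h)
  have hx := norm_nonneg x
  have hy := norm_nonneg y
  rw [abs_le]
  constructor <;> nlinarith

theorem abs_f_retract_sub_le {ρ : QERetraction} {u ζ : FlowVec J} {t B C : ℝ}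
    (hζ : N.IsDirection u ζ) (hC : 0 ≤ C) (hB : ‖ζ‖ ≤ B * ‖N.A u - N.b‖)
    (hR : ‖N.retract ρ (u + t • ζ) - (u + t • ζ)‖ ≤ C * ‖t • ζ‖ ^ 2) :
    |N.f (N.retract ρ (u + t • ζ)) - (1 - t) ^ 2 * ‖N.A u - N.b‖ ^ 2| ≤
      2 * (|1 - t| * ‖N.A u - N.b‖) * (‖N.A‖ * C * B ^ 2 * t ^ 2 * ‖N.A u - N.b‖ ^ 2) +
        (‖N.A‖ * C * B ^ 2 * t ^ 2 * ‖N.A u - N.b‖ ^ 2) ^ 2 := by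
  have h := abs_norm_sq_sub_norm_sq_le (norm_residual_retract_sub_le hζ hC hB hR)
  rwa [norm_smul, Real.norm_eq_abs, mul_pow, sq_abs] at h

theorem armijoCond_iff {ρ : QERetraction} {σ t : ℝ} {u ζ : FlowVec J} (hζ : N.IsDirection u ζ) :
    N.ArmijoCond ρ σ u ζ t ↔ N.RetractDefined ρ (u + t • ζ) ∧
      N.f (N.retract ρ (u + t • ζ)) + 2 * σ * t * ‖N.A u - N.b‖ ^ 2 ≤ ‖N.A u - N.b‖ ^ 2 := by
  rw [ArmijoCond, real_inner_smul_right, N.inner_grad_direction hζ]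
  refine and_congr_right fun _ => ?_
  rw [ge_iff_le, le_sub_iff_add_le]
  have : -(σ * (t * -(2 * ‖N.A u - N.b‖ ^ 2))) + N.f (N.retract ρ (u + t • ζ)) =
      N.f (N.retract ρ (u + t • ζ)) + 2 * σ * t * ‖N.A u - N.b‖ ^ 2 := by ring
  rw [this]; rfl

/-- With c = ‖A‖CB² and t ≤ 1, the bound on the new f is at most (1 - 2t)r² + t²r²(1 + c r)².
Comparison with (1 - 2σt)r² gives exactly the hypothesis `ht`. -/
theorem armijoCond_of_small {ρ : QERetraction} {σ t B C : ℝ} {u ζ : FlowVec J}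
    (hζ : N.IsDirection u ζ) (hC : 0 ≤ C) (hB : ‖ζ‖ ≤ B * ‖N.A u - N.b‖)
    (hd : N.RetractDefined ρ (u + t • ζ))
    (hR : ‖N.retract ρ (u + t • ζ) - (u + t • ζ)‖ ≤ C * ‖t • ζ‖ ^ 2)
    (ht0 : 0 < t) (ht1 : t ≤ 1)
    (ht : t * (1 + ‖N.A‖ * C * B ^ 2 * ‖N.A u - N.b‖) ^ 2 ≤ 2 * (1 - σ)) :
    N.ArmijoCond ρ σ u ζ t := by
  refine (armijoCond_iff hζ).2 ⟨hd, ?_⟩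
  have h := (abs_le.1 (abs_f_retract_sub_le hζ hC hB hR)).2
  have hc : 0 ≤ ‖N.A‖ * C * B ^ 2 := by positivity
  have hr := norm_nonneg (N.A u - N.b)
  generalize ‖N.A‖ * C * B ^ 2 = c at *
  generalize ‖N.A u - N.b‖ = r at *
  generalize N.f (N.retract ρ (u + t • ζ)) = g at *
  rw [abs_of_nonneg (by linarith)] at h
  have h1 : 2 * ((1 - t) * r) * (c * t ^ 2 * r ^ 2) ≤ 2 * r * (c * t ^ 2 * r ^ 2) := by
    gcongr
    nlinarith
  have h2 : (c * t ^ 2 * r ^ 2) ^ 2 ≤ c ^ 2 * t ^ 2 * r ^ 4 := by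
    have : t ^ 4 ≤ t ^ 2 := pow_le_pow_of_le_one ht0.le ht1 (by norm_num)
    calc _ = c ^ 2 * t ^ 4 * r ^ 4 := by ring
      _ ≤ _ := by gcongr
  have h3 : t * r ^ 2 * (t * (1 + c * r) ^ 2) ≤ t * r ^ 2 * (2 * (1 - σ)) := by gcongr
  linarith [h3]

/-- At t = 1 the linear residual term vanishes, leaving f ≤ c²r⁴, to be compared with (1 - 2σ)r². -/
theorem armijoCond_one {ρ : QERetraction} {σ B C : ℝ} {u ζ : FlowVec J}
    (hζ : N.IsDirection u ζ) (hC : 0 ≤ C) (hB : ‖ζ‖ ≤ B * ‖N.A u - N.b‖)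
    (hd : N.RetractDefined ρ (u + (1 : ℝ) • ζ))
    (hR : ‖N.retract ρ (u + (1 : ℝ) • ζ) - (u + (1 : ℝ) • ζ)‖ ≤ C * ‖(1 : ℝ) • ζ‖ ^ 2)
    (ht : (‖N.A‖ * C * B ^ 2 * ‖N.A u - N.b‖) ^ 2 ≤ 1 - 2 * σ) :
    N.ArmijoCond ρ σ u ζ 1 := by
  refine (armijoCond_iff hζ).2 ⟨hd, ?_⟩
  have h := (abs_le.1 (abs_f_retract_sub_le hζ hC hB hR)).2
  generalize ‖N.A‖ * C * B ^ 2 = c at *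
  generalize ‖N.A u - N.b‖ = r at *
  rw [sub_self, abs_zero] at h
  have := mul_le_mul_of_nonneg_right ht (sq_nonneg r)
  linarith

/-- Here (1 - t)² + 2σt - 1 = t(t - 2(1 - σ)); `ht` says that this excess outweighs the error terms
after division by r². -/
theorem not_armijoCond {ρ : QERetraction} {σ t B C : ℝ} {u ζ : FlowVec J}
    (hζ : N.IsDirection u ζ) (hC : 0 ≤ C) (hB : ‖ζ‖ ≤ B * ‖N.A u - N.b‖)
    (hR : ‖N.retract ρ (u + t • ζ) - (u + t • ζ)‖ ≤ C * ‖t • ζ‖ ^ 2)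
    (hr : 0 < ‖N.A u - N.b‖)
    (ht : ‖N.A u - N.b‖ * (2 * |1 - t| * (‖N.A‖ * C * B ^ 2) * t ^ 2 +
      (‖N.A‖ * C * B ^ 2) ^ 2 * t ^ 4 * ‖N.A u - N.b‖) < t * (t - 2 * (1 - σ))) :
    ¬ N.ArmijoCond ρ σ u ζ t := by
  intro hA
  have h1 := ((armijoCond_iff hζ).1 hA).2
  have h := (abs_le.1 (abs_f_retract_sub_le hζ hC hB hR)).1
  generalize ‖N.A‖ * C * B ^ 2 = c at *
  generalize ‖N.A u - N.b‖ = r at *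
  have := mul_lt_mul_of_pos_right ht (pow_pos hr 2)
  linarith

theorem ArmijoStep.exists_of_cond {ρ : QERetraction} {α β σ : ℝ} {u ζ : FlowVec J}
    (h : ∃ m : ℕ, N.ArmijoCond ρ σ u ζ (β ^ m * α)) : ∃ t, N.ArmijoStep ρ α β σ u ζ t :=
  ⟨_, _, ⟨Nat.sInf_mem h, fun _ hm => Nat.sInf_le hm⟩, rfl⟩

theorem ArmijoStep.cond {ρ : QERetraction} {α β σ t : ℝ} {u ζ : FlowVec J}
    (h : N.ArmijoStep ρ α β σ u ζ t) : N.ArmijoCond ρ σ u ζ t := by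
  obtain ⟨m, hm, rfl⟩ := h
  exact hm.1

theorem ArmijoStep.pos {ρ : QERetraction} {α β σ t : ℝ} {u ζ : FlowVec J} (hα : 0 < α)
    (hβ : 0 < β) (h : N.ArmijoStep ρ α β σ u ζ t) : 0 < t := by
  obtain ⟨m, -, rfl⟩ := h
  positivity

/-- Near a point of the manifold some fixed power of `β` satisfies Armijo's condition, as long as
the directions are bounded by the residuals. -/
theorem exists_uniform_armijoCond {ρ : QERetraction} {α β σ B C δ M : ℝ} {z : FlowVec J}
    (hα : 0 < α) (hβ : β ∈ Set.Ioo (0 : ℝ) 1) (hσ : σ < 1) (hB : 0 ≤ B) (hC : 0 ≤ C) (hδ : 0 < δ)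
    (hR : ∀ u ∈ N.MQE, ∀ x, N.DF u x = 0 → ‖u + x - z‖ < δ →
      N.RetractDefined ρ (u + x) ∧ ‖N.retract ρ (u + x) - (u + x)‖ ≤ C * ‖x‖ ^ 2) :
    ∃ m : ℕ, ∀ u ∈ N.MQE, ∀ ζ, N.IsDirection u ζ → ‖ζ‖ ≤ B * ‖N.A u - N.b‖ →
      ‖N.A u - N.b‖ ≤ M → ‖u - z‖ < δ / 2 → N.ArmijoCond ρ σ u ζ (β ^ m * α) := by
  have ht : Tendsto (fun m : ℕ => β ^ m * α) atTop (𝓝 0) := by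
    simpa using (tendsto_pow_atTop_nhds_zero_of_lt_one hβ.1.le hβ.2).mul_const α
  have h1 := ht.eventually (ge_mem_nhds (zero_lt_one (α := ℝ)))
  have h2 : ∀ᶠ m : ℕ in atTop, β ^ m * α * (B * M) < δ / 2 := by
    have := ht.mul_const (B * M)
    rw [zero_mul] at this
    exact this.eventually (gt_mem_nhds (by positivity))
  have h3 : ∀ᶠ m : ℕ in atTop, β ^ m * α * (1 + ‖N.A‖ * C * B ^ 2 * M) ^ 2 < 2 * (1 - σ) := by
    have := ht.mul_const ((1 + ‖N.A‖ * C * B ^ 2 * M) ^ 2)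
    rw [zero_mul] at this
    exact this.eventually (gt_mem_nhds (by linarith))
  obtain ⟨m, h1, h2, h3⟩ := (h1.and (h2.and h3)).exists
  have ht0 : 0 < β ^ m * α := mul_pos (pow_pos hβ.1 m) hα
  refine ⟨m, fun u hu ζ hζ hζB hM huz => ?_⟩
  obtain ⟨hd, hr⟩ := hR u hu ((β ^ m * α) • ζ) (by rw [map_smul, hζ.1, smul_zero]) (by
    rw [add_sub_right_comm]
    refine (norm_add_le _ _).trans_lt ?_
    have : ‖(β ^ m * α) • ζ‖ ≤ β ^ m * α * (B * M) := by
      rw [norm_smul, Real.norm_of_nonneg ht0.le]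
      gcongr
      exact hζB.trans (by gcongr)
    linarith)
  refine armijoCond_of_small hζ hC hζB hd hr ht0 h1 (le_trans ?_ h3.le)
  gcongr

theorem exists_armijoStep (ρ : QERetraction) {α β σ : ℝ} (hα : 0 < α)
    (hβ : β ∈ Set.Ioo (0 : ℝ) 1) (hσ : σ < 1) {u ζ : FlowVec J} (hu : u ∈ N.MQE)
    (hζ : N.IsDirection u ζ) (hf : N.f u ≠ 0) : ∃ t, N.ArmijoStep ρ α β σ u ζ t := by
  obtain ⟨C, hC, δ, hδ, hR⟩ := N.exists_retract_second_order ρ hu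
  have hr : ‖N.A u - N.b‖ ≠ 0 := fun h => hf (by rw [f, h]; norm_num)
  -- The uniform lemma is used at the single point u, where no regularity is assumed; this B makes
  -- the direction bound an equality.
  obtain ⟨m, hm⟩ := exists_uniform_armijoCond (B := ‖ζ‖ / ‖N.A u - N.b‖)
    (M := ‖N.A u - N.b‖) hα hβ hσ (by positivity) hC hδ hR
  refine ArmijoStep.exists_of_cond ⟨m, hm u hu ζ hζ ?_ le_rfl (by simpa using hδ)⟩
  rw [div_mul_cancel₀ _ hr]

theorem ArmijoStep.f_add_le {ρ : QERetraction} {α β σ t : ℝ} {u ζ : FlowVec J}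
    (hζ : N.IsDirection u ζ) (h : N.ArmijoStep ρ α β σ u ζ t) :
    N.f (N.retract ρ (u + t • ζ)) + 2 * σ * t * N.f u ≤ N.f u :=
  ((armijoCond_iff hζ).1 h.cond).2

theorem IsRun.mem {ρ : QERetraction} {α β σ ε : ℝ} {s : ℕ → FlowVec J}
    (h : N.IsRun ρ (N.ArmijoStep ρ α β σ) ε s) (k : ℕ) : s k ∈ N.MQE := by
  induction k with
  | zero => exact h.1
  | succ k ih =>
    rcases lt_or_ge ε ‖N.grad (s k)‖ with hg | hg
    · obtain ⟨ζ, t, -, ht, hs⟩ := (h.2 k).1 hg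
      rw [hs]
      exact N.retract_mem ht.cond.1
    · rwa [(h.2 k).2 hg]

theorem IsRun.f_lt {ρ : QERetraction} {α β σ ε : ℝ} {s : ℕ → FlowVec J} (hα : 0 < α) (hβ : 0 < β)
    (hσ : 0 < σ) (hε : 0 ≤ ε) (h : N.IsRun ρ (N.ArmijoStep ρ α β σ) ε s) {k : ℕ}
    (hg : ε < ‖N.grad (s k)‖) : N.f (s (k + 1)) < N.f (s k) := by
  obtain ⟨ζ, t, hζ, ht, hs⟩ := (h.2 k).1 hg
  have h1 := ht.f_add_le hζ
  have h2 := ht.pos hα hβ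
  have h3 := f_pos_of_grad_ne_zero (norm_pos_iff.1 (hε.trans_lt hg))
  have : 0 < 2 * σ * t * N.f (s k) := by positivity
  rw [hs]
  linarith

theorem IsRun.antitone_f {ρ : QERetraction} {α β σ ε : ℝ} {s : ℕ → FlowVec J} (hα : 0 < α)
    (hβ : 0 < β) (hσ : 0 < σ) (hε : 0 ≤ ε) (h : N.IsRun ρ (N.ArmijoStep ρ α β σ) ε s) :
    Antitone fun k => N.f (s k) := by
  refine antitone_nat_of_succ_le fun k => ?_
  rcases lt_or_ge ε ‖N.grad (s k)‖ with hg | hg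
  · exact (h.f_lt hα hβ hσ hε hg).le
  · rw [(h.2 k).2 hg]

/-- If grad f(z) ≠ 0, then f stays above f(z)/2 near z and Armijo steps there are at least β^m α for
one fixed m. Every visit near z lowers f by a fixed amount, yet the decreasing values f(s k)
converge. -/
theorem IsRun.grad_eq_zero_of_mapClusterPt {ρ : QERetraction} {α β σ : ℝ} {s : ℕ → FlowVec J}
    (hα : 0 < α) (hβ : β ∈ Set.Ioo (0 : ℝ) 1) (hσ : σ ∈ Set.Ioo (0 : ℝ) 1)
    (h : N.IsRun ρ (N.ArmijoStep ρ α β σ) 0 s) {z : FlowVec J} (hz : z ∈ N.MQE)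
    (hreg : N.RowsIndep z) (hcl : MapClusterPt z atTop s) : N.grad z = 0 := by
  by_contra hgz
  have hfz := f_pos_of_grad_ne_zero hgz
  obtain ⟨B, hB, hM⟩ := hreg.eventually_bound
  obtain ⟨C, hC, δ, hδ, hR⟩ := N.exists_retract_second_order ρ hz
  have hres : ContinuousAt (fun u => ‖N.A u - N.b‖) z :=
    ((N.A.continuous.sub continuous_const).norm).continuousAt
  obtain ⟨m, hm⟩ := exists_uniform_armijoCond (M := ‖N.A z - N.b‖ + 1) hα hβ hσ.2 hB.le hC hδ hR
  have hnear : ∀ᶠ u in 𝓝 z, N.f z / 2 < N.f u ∧ ‖N.A u - N.b‖ < ‖N.A z - N.b‖ + 1 ∧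
      ‖u - z‖ < δ / 2 ∧ (∀ x, ‖x‖ ≤ B * ‖((N.DF u).prod N.A) x‖) ∧
        Function.Surjective ((N.DF u).prod N.A) := by
    refine (continuous_f.continuousAt.eventually (lt_mem_nhds (by linarith))).and
      ((hres.eventually (gt_mem_nhds (by linarith))).and (Eventually.and ?_ hM))
    filter_upwards [Metric.ball_mem_nhds z (half_pos hδ)] with u hu
    rwa [← dist_eq_norm]
  have hanti := h.antitone_f hα hβ.1 hσ.1 le_rfl
  have hlim := tendsto_atTop_ciInf hanti ⟨0, by rintro _ ⟨k, rfl⟩; exact sq_nonneg _⟩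
  have hdiff : Tendsto (fun k => N.f (s k) - N.f (s (k + 1))) atTop (𝓝 0) := by
    simpa using hlim.sub (hlim.comp (tendsto_add_atTop_nat 1))
  have hη : 0 < σ * (β ^ m * α) * N.f z := mul_pos (mul_pos hσ.1 (mul_pos (pow_pos hβ.1 m) hα)) hfz
  obtain ⟨k, ⟨h1, h2, h3, h4, h5⟩, hk⟩ :=
    ((hcl.frequently hnear).and_eventually (hdiff.eventually (gt_mem_nhds hη))).exists
  -- The run has not stopped at this iterate: a zero gradient would force a zero residual by
  -- regularity, against f > f(z)/2.
  have hgk : 0 < ‖N.grad (s k)‖ := by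
    by_contra! hle
    have h6 : ‖N.grad (s k)‖ = 0 := le_antisymm hle (norm_nonneg _)
    have h7 := N.norm_residual_le h4 h5
    rw [h6, mul_zero] at h7
    have h8 : N.f (s k) = 0 := by
      rw [f, le_antisymm h7 (norm_nonneg _)]; norm_num
    linarith
  obtain ⟨ζ, t, hζ, ht, hs⟩ := (h.2 k).1 hgk
  have hdec := ht.f_add_le hζ
  rw [← hs] at hdec
  have htm : β ^ m * α ≤ t := by
    obtain ⟨m', hm', rfl⟩ := ht
    gcongr ?_ * α
    exact pow_le_pow_of_le_one hβ.1.le hβ.2.le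
      (hm'.2 (hm (s k) (h.mem k) ζ hζ (hζ.norm_le h4) h2.le h3))
  have hσ0 := hσ.1
  have ht0 := ht.pos hα hβ.1
  have : σ * (β ^ m * α) * N.f z ≤ σ * t * (2 * N.f (s k)) := by
    gcongr
    linarith
  linarith

/-! ### Local superlinear convergence -/

/-- A stepsize rule whose iterates contract quadratically towards `z` near `z` converges
superlinearly. -/
theorem locallySuperlinear_of_quadratic {ρ : QERetraction}
    {rule : FlowVec J → FlowVec J → ℝ → Prop} {z : FlowVec J} {κ δ : ℝ} (hκ : 0 ≤ κ) (hδ : 0 < δ)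
    (hfix : ∀ u ∈ N.MQE, ‖u - z‖ < δ → N.grad u = 0 → u = z)
    (hex : ∀ u ∈ N.MQE, ‖u - z‖ < δ → N.grad u ≠ 0 → ∃ ζ t, N.IsDirection u ζ ∧ rule u ζ t)
    (hquad : ∀ u ∈ N.MQE, ‖u - z‖ < δ → N.grad u ≠ 0 → ∀ ζ t, N.IsDirection u ζ → rule u ζ t →
      N.retract ρ (u + t • ζ) ∈ N.MQE ∧
        ‖N.retract ρ (u + t • ζ) - z‖ ≤ κ * ‖u - z‖ ^ 2) :
    N.LocallySuperlinear ρ rule z := by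
  let step : FlowVec J → FlowVec J → Prop := fun u u' =>
    (0 < ‖N.grad u‖ → ∃ ζ t, N.IsDirection u ζ ∧ rule u ζ t ∧ u' = N.retract ρ (u + t • ζ)) ∧
      (‖N.grad u‖ ≤ 0 → u' = u)
  -- This gives κη ≤ 1/2, so steps at least halve the distance and stay in the ball; the +1 covers κ
  -- = 0.
  set η := min δ (1 / (2 * κ + 1))
  have hη : 0 < η := lt_min hδ (by positivity)
  have hκη : κ * η ≤ 1 / 2 := by
    have h1 : κ * η ≤ κ * (1 / (2 * κ + 1)) := by gcongr; exact min_le_right _ _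
    refine h1.trans ?_
    rw [mul_one_div, div_le_div_iff₀ (by positivity) (by norm_num)]
    linarith
  have hnext : ∀ u ∈ N.MQE, ‖u - z‖ < η → ∀ u', step u u' →
      u' ∈ N.MQE ∧ ‖u' - z‖ ≤ κ * ‖u - z‖ ^ 2 ∧ ‖u' - z‖ ≤ 1 / 2 * ‖u - z‖ := by
    intro u hu huz u' hs
    have huδ := huz.trans_le (min_le_left _ _)
    have key : u' ∈ N.MQE ∧ ‖u' - z‖ ≤ κ * ‖u - z‖ ^ 2 := by
      by_cases hg : N.grad u = 0
      · rw [hs.2 (by simp [hg])]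
        refine ⟨hu, ?_⟩
        simp [hfix u hu huδ hg]
      · obtain ⟨ζ, t, hζ, ht, rfl⟩ := hs.1 (norm_pos_iff.2 hg)
        exact hquad u hu huδ hg ζ t hζ ht
    refine ⟨key.1, key.2, key.2.trans ?_⟩
    rw [sq, ← mul_assoc]
    gcongr
    exact (by gcongr : κ * ‖u - z‖ ≤ κ * η).trans hκη
  have hexists : ∀ u : {u // u ∈ N.MQE ∧ ‖u - z‖ < η}, ∃ u' : {u // u ∈ N.MQE ∧ ‖u - z‖ < η},
      step u u' := by
    rintro ⟨u, hu, huz⟩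
    have huδ := huz.trans_le (min_le_left _ _)
    suffices h : ∃ u', step u u' by
      obtain ⟨u', hu'⟩ := h
      obtain ⟨h1, -, h3⟩ := hnext u hu huz u' hu'
      exact ⟨⟨u', h1, by linarith [norm_nonneg (u - z)]⟩, hu'⟩
    by_cases hg : N.grad u = 0
    · exact ⟨u, fun h => absurd h (by simp [hg]), fun _ => rfl⟩
    · obtain ⟨ζ, t, hζ, ht⟩ := hex u hu huδ hg
      exact ⟨_, fun _ => ⟨ζ, t, hζ, ht, rfl⟩,
        fun h => absurd (norm_le_zero_iff.1 h) hg⟩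
  refine ⟨Metric.ball z η, Metric.ball_mem_nhds z hη, ?_⟩
  rintro u ⟨huz, hu⟩
  rw [mem_ball_iff_norm] at huz
  constructor
  · choose g hg using hexists
    refine ⟨fun k => (g^[k] ⟨u, hu, huz⟩ : FlowVec J), ⟨hu, fun k => ?_⟩, rfl⟩
    simp only [Function.iterate_succ_apply']
    exact hg _
  · rintro s ⟨hs0, hs⟩ rfl
    have hall : ∀ k, s k ∈ N.MQE ∧ ‖s k - z‖ < η ∧ ‖s k - z‖ ≤ (1 / 2) ^ k * ‖s 0 - z‖ := by
      intro k
      induction k with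
      | zero => exact ⟨hu, huz, by simp⟩
      | succ k ih =>
        obtain ⟨h1, -, h3⟩ := hnext _ ih.1 ih.2.1 _ (hs k)
        refine ⟨h1, by linarith [norm_nonneg (s k - z), ih.2.1], ?_⟩
        rw [pow_succ]
        linarith [ih.2.2]
    have hlim : Tendsto s atTop (𝓝 z) := by
      rw [tendsto_iff_norm_sub_tendsto_zero]
      refine squeeze_zero (fun _ => norm_nonneg _) (fun k => (hall k).2.2) ?_
      simpa using (tendsto_pow_atTop_nhds_zero_of_lt_one (r := (1 / 2 : ℝ)) (by norm_num)
        (by norm_num)).mul_const ‖s 0 - z‖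
    refine ⟨hlim, ?_⟩
    have hO : (fun k => s (k + 1) - z) =O[atTop] fun k => ‖s k - z‖ ^ 2 :=
      Asymptotics.IsBigO.of_bound κ (Eventually.of_forall fun k => by
        rw [Real.norm_of_nonneg (by positivity)]
        exact (hnext _ (hall k).1 (hall k).2.1 _ (hs k)).2.1)
    have hlim0 : Tendsto (fun k => s k - z) atTop (𝓝 0) := by
      simpa using hlim.sub_const z
    exact hO.trans_isLittleO
      ((Asymptotics.isLittleO_norm_pow_id (by norm_num)).comp_tendsto hlim0)

/-- Newton's estimate: A annihilates u + ζ - z, and expanding F(z) = 0 about u gives DF(u)(u + ζ -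
z) = `quadF` (z - u). -/
theorem norm_sub_le_of_solution {u ζ z : FlowVec J} {B : ℝ} (hB0 : 0 ≤ B)
    (hB : ∀ x, ‖x‖ ≤ B * ‖((N.DF u).prod N.A) x‖) (hu : u ∈ N.MQE) (hz : z ∈ N.MQE)
    (hAz : N.A z = N.b) (hζ : N.IsDirection u ζ) :
    ‖u + ζ - z‖ ≤ B * (3 * J) * ‖u - z‖ ^ 2 := by
  have hA : N.A (u + ζ - z) = 0 := by rw [map_sub, hζ.2, hAz, sub_self]
  have hD : N.DF u (u + ζ - z) = N.quadF (z - u) := by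
    have h := N.F_add u (z - u)
    rw [add_sub_cancel, hu.1, hz.1, zero_add] at h
    rw [add_sub_right_comm, map_add, hζ.1, add_zero, ← neg_sub z u, map_neg]
    exact (eq_neg_of_add_eq_zero_right h.symm).symm
  refine (hB _).trans ?_
  rw [ContinuousLinearMap.prod_apply, hA, hD, Prod.norm_def, norm_zero,
    max_eq_left (norm_nonneg _), mul_assoc]
  gcongr
  rw [norm_sub_rev u z]
  exact N.norm_quadF_le _

/-- The local estimates behind superlinear convergence, on a ball around a regular solution. -/
theorem exists_local_estimates (ρ : QERetraction) {z : FlowVec J} (hz : z ∈ N.MQE)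
    (hAz : N.A z = N.b) (hreg : N.RowsIndep z) :
    ∃ B C κ δ η : ℝ, 0 ≤ B ∧ 0 ≤ C ∧ 0 ≤ κ ∧ 0 < δ ∧ 0 < η ∧
      (∀ u ∈ N.MQE, ∀ x, N.DF u x = 0 → ‖u + x - z‖ < δ →
        N.RetractDefined ρ (u + x) ∧ ‖N.retract ρ (u + x) - (u + x)‖ ≤ C * ‖x‖ ^ 2) ∧
      ∀ u ∈ N.MQE, ‖u - z‖ < η →
        (N.grad u = 0 → u = z) ∧ (∃ ζ, N.IsDirection u ζ) ∧ ∀ ζ, N.IsDirection u ζ →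
          ‖ζ‖ ≤ B * ‖N.A u - N.b‖ ∧ N.RetractDefined ρ (u + (1 : ℝ) • ζ) ∧
          ‖N.retract ρ (u + (1 : ℝ) • ζ) - (u + (1 : ℝ) • ζ)‖ ≤ C * ‖(1 : ℝ) • ζ‖ ^ 2 ∧
          ‖N.retract ρ (u + (1 : ℝ) • ζ) - z‖ ≤ κ * ‖u - z‖ ^ 2 := by
  obtain ⟨B, hB, hM⟩ := hreg.eventually_bound
  obtain ⟨C, hC, δ, hδ, hR⟩ := N.exists_retract_second_order ρ hz
  obtain ⟨δ', hδ', hM⟩ := Metric.eventually_nhds_iff.1 hM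
  set a := B * (3 * J)
  have ha0 : 0 ≤ a := by positivity
  -- The bound 1 gives a‖u - z‖ < 1; together with (a + 1)‖u - z‖ < δ it puts u + ζ within δ of z.
  set η := min δ' (min δ 1 / (a + 1))
  refine ⟨B, C, a + C * (B * ‖N.A‖) ^ 2, δ, η, hB.le, hC, by positivity, hδ,
    lt_min hδ' (by positivity), hR, fun u hu huz => ?_⟩
  obtain ⟨h1, h2⟩ := hM (y := u) (by rw [dist_eq_norm]; exact huz.trans_le (min_le_left _ _))
  have hlt : (a + 1) * ‖u - z‖ < min δ 1 := by
    have := huz.trans_le (min_le_right _ _)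
    rwa [lt_div_iff₀' (by positivity)] at this
  have hlt1 : (a + 1) * ‖u - z‖ < 1 := hlt.trans_le (min_le_right _ _)
  have hltδ : (a + 1) * ‖u - z‖ < δ := hlt.trans_le (min_le_left _ _)
  have hn := norm_nonneg (u - z)
  refine ⟨fun hg => ?_, N.exists_direction h2, fun ζ hζ => ?_⟩
  · have hr := N.norm_residual_le h1 h2
    rw [hg, norm_zero, mul_zero] at hr
    -- With zero residual, 0 is a direction, so ‖u - z‖ ≤ a‖u - z‖², which a‖u - z‖ < 1 allows only
    -- for u = z.
    have hdir : N.IsDirection u 0 := ⟨map_zero _, by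
      rw [add_zero]; exact sub_eq_zero.1 (norm_le_zero_iff.1 hr)⟩
    have h3 := norm_sub_le_of_solution hB.le h1 hu hz hAz hdir
    rw [add_zero] at h3
    rw [← sub_eq_zero, ← norm_le_zero_iff]
    by_contra! hpos
    nlinarith
  · have h3 := norm_sub_le_of_solution hB.le h1 hu hz hAz hζ
    have h4 := hζ.norm_le h1
    obtain ⟨h5, h6⟩ := hR u hu ζ hζ.1 (h3.trans_lt (by nlinarith))
    rw [one_smul]
    refine ⟨h4, h5, h6, ?_⟩
    have h7 : ‖N.A u - N.b‖ ≤ ‖N.A‖ * ‖u - z‖ := by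
      rw [← hAz, ← map_sub]; exact N.A.le_opNorm _
    have h8 : ‖ζ‖ ≤ B * ‖N.A‖ * ‖u - z‖ := h4.trans (by rw [mul_assoc]; gcongr)
    calc _ ≤ ‖N.retract ρ (u + ζ) - (u + ζ)‖ + ‖u + ζ - z‖ := norm_sub_le_norm_sub_add_norm_sub ..
      _ ≤ C * (B * ‖N.A‖ * ‖u - z‖) ^ 2 + a * ‖u - z‖ ^ 2 := by
        gcongr
        exact h6.trans (by gcongr)
      _ = _ := by ring

theorem locallySuperlinear_unitStep (ρ : QERetraction) {z : FlowVec J} (hz : z ∈ N.MQE)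
    (hAz : N.A z = N.b) (hreg : N.RowsIndep z) : N.LocallySuperlinear ρ (N.UnitStep ρ) z := by
  obtain ⟨B, C, κ, δ, η, -, -, hκ, -, hη, -, h⟩ := exists_local_estimates ρ hz hAz hreg
  refine locallySuperlinear_of_quadratic hκ hη (fun u hu huz => (h u hu huz).1) ?_ ?_
  · intro u hu huz _
    obtain ⟨-, ⟨ζ, hζ⟩, h'⟩ := h u hu huz
    exact ⟨ζ, 1, hζ, (h' ζ hζ).2.1, rfl⟩
  · rintro u hu huz - ζ t hζ ⟨hd, rfl⟩
    exact ⟨N.retract_mem hd, ((h u hu huz).2.2 ζ hζ).2.2.2⟩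

/-- Near a regular solution Armijo's rule accepts exactly the full step. -/
theorem exists_armijoStep_iff_eq_one {ρ : QERetraction} {α β σ B C δ η : ℝ} {z : FlowVec J}
    (hα : 0 < α) (hβ : 0 < β) (hσ : σ < 1 / 2) {m₀ : ℕ} (hm₀ : β ^ m₀ * α = 1)
    (hm : ∀ m < m₀, 2 * (1 - σ) < β ^ m * α) (hAz : N.A z = N.b) (hC : 0 ≤ C)
    (hδ : 0 < δ) (hη : 0 < η)
    (hR : ∀ u ∈ N.MQE, ∀ x, N.DF u x = 0 → ‖u + x - z‖ < δ →
      N.RetractDefined ρ (u + x) ∧ ‖N.retract ρ (u + x) - (u + x)‖ ≤ C * ‖x‖ ^ 2)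
    (hloc : ∀ u ∈ N.MQE, ‖u - z‖ < η → ∀ ζ, N.IsDirection u ζ → ‖ζ‖ ≤ B * ‖N.A u - N.b‖) :
    ∃ θ > 0, ∀ u ∈ N.MQE, ‖u - z‖ < θ → N.grad u ≠ 0 → ∀ ζ, N.IsDirection u ζ →
      ∀ t, N.ArmijoStep ρ α β σ u ζ t ↔ t = 1 := by
  set c := ‖N.A‖ * C * B ^ 2
  have hres : Tendsto (fun u => ‖N.A u - N.b‖) (𝓝 z) (𝓝 0) := by
    have h : Continuous fun u => ‖N.A u - N.b‖ := (N.A.continuous.sub continuous_const).norm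
    simpa [hAz] using h.tendsto z
  have hdist : Tendsto (fun u => ‖u - z‖) (𝓝 z) (𝓝 0) := by
    have h : Continuous fun u : FlowVec J => ‖u - z‖ := by fun_prop
    simpa using h.tendsto z
  have hclose : ∀ t : ℝ, ∀ᶠ u in 𝓝 z, ‖u - z‖ + |t| * (B * ‖N.A u - N.b‖) < δ := fun t => by
    have := hdist.add ((hres.const_mul B).const_mul |t|)
    simp only [mul_zero, add_zero] at this
    exact this.eventually (gt_mem_nhds hδ)
  have hone : ∀ᶠ u in 𝓝 z, (c * ‖N.A u - N.b‖) ^ 2 < 1 - 2 * σ := by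
    have := (hres.const_mul c).pow 2
    simp only [mul_zero, ne_eq, OfNat.ofNat_ne_zero, not_false_eq_true, zero_pow] at this
    exact this.eventually (gt_mem_nhds (by linarith))
  -- For each of the finitely many m < m₀ the left side tends to 0 with the residual, while the
  -- right side is a positive constant by `hm`.
  have hfail : ∀ᶠ u in 𝓝 z, ∀ m < m₀,
      ‖N.A u - N.b‖ * (2 * |1 - β ^ m * α| * c * (β ^ m * α) ^ 2 +
        c ^ 2 * (β ^ m * α) ^ 4 * ‖N.A u - N.b‖) < β ^ m * α * (β ^ m * α - 2 * (1 - σ)) ∧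
      ‖u - z‖ + |β ^ m * α| * (B * ‖N.A u - N.b‖) < δ := by
    have := (Set.finite_lt_nat m₀).eventually_all (l := 𝓝 z)
      (p := fun m u => ‖N.A u - N.b‖ * (2 * |1 - β ^ m * α| * c * (β ^ m * α) ^ 2 +
        c ^ 2 * (β ^ m * α) ^ 4 * ‖N.A u - N.b‖) < β ^ m * α * (β ^ m * α - 2 * (1 - σ)) ∧
      ‖u - z‖ + |β ^ m * α| * (B * ‖N.A u - N.b‖) < δ)
    refine this.2 fun m hlt => Eventually.and ?_ (hclose _)
    have h1 := hres.mul ((hres.const_mul (c ^ 2 * (β ^ m * α) ^ 4)).const_add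
      (2 * |1 - β ^ m * α| * c * (β ^ m * α) ^ 2))
    rw [zero_mul] at h1
    exact h1.eventually (gt_mem_nhds (mul_pos (by positivity) (by linarith [hm m hlt])))
  obtain ⟨θ, hθ, h⟩ := Metric.eventually_nhds_iff.1 ((hclose 1).and (hone.and hfail))
  refine ⟨min θ η, lt_min hθ hη, fun u hu huz hg ζ hζ t => ?_⟩
  obtain ⟨h1, h2, h3⟩ := h (y := u) (by rw [dist_eq_norm]; exact huz.trans_le (min_le_left _ _))
  have hζB := hloc u hu (huz.trans_le (min_le_right _ _)) ζ hζ
  have hr : 0 < ‖N.A u - N.b‖ := by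
    rw [norm_pos_iff, sub_ne_zero]
    exact fun h => hg (N.grad_eq_zero_of_residual h)
  have hR' : ∀ t : ℝ, ‖u - z‖ + |t| * (B * ‖N.A u - N.b‖) < δ →
      N.RetractDefined ρ (u + t • ζ) ∧
        ‖N.retract ρ (u + t • ζ) - (u + t • ζ)‖ ≤ C * ‖t • ζ‖ ^ 2 := fun t ht => by
    refine hR u hu (t • ζ) (by rw [map_smul, hζ.1, smul_zero]) ?_
    rw [add_sub_right_comm]
    refine (norm_add_le _ _).trans_lt (lt_of_le_of_lt ?_ ht)
    rw [norm_smul, Real.norm_eq_abs]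
    gcongr
  have hleast : IsLeast {m : ℕ | N.ArmijoCond ρ σ u ζ (β ^ m * α)} m₀ := by
    constructor
    · rw [Set.mem_ofPred_eq, hm₀]
      obtain ⟨hd, hr'⟩ := hR' 1 h1
      exact armijoCond_one hζ hC hζB hd hr' h2.le
    · intro m hmem
      by_contra! hlt
      obtain ⟨h4, h5⟩ := h3 m hlt
      exact not_armijoCond hζ hC hζB (hR' _ h5).2 hr h4 hmem
  constructor
  · rintro ⟨m, hmin, rfl⟩
    rw [hmin.unique hleast, hm₀]
  · rintro rfl
    exact ⟨m₀, hleast, hm₀.symm⟩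

theorem locallySuperlinear_armijoStep (ρ : QERetraction) {α β σ : ℝ} (hα : 0 < α) (hβ : 0 < β)
    (hσ : σ < 1 / 2) {m₀ : ℕ} (hm₀ : β ^ m₀ * α = 1) (hm : ∀ m < m₀, 2 * (1 - σ) < β ^ m * α)
    {z : FlowVec J} (hz : z ∈ N.MQE) (hAz : N.A z = N.b) (hreg : N.RowsIndep z) :
    N.LocallySuperlinear ρ (N.ArmijoStep ρ α β σ) z := by
  obtain ⟨B, C, κ, δ, η, -, hC, hκ, hδ, hη, hR, h⟩ := exists_local_estimates ρ hz hAz hreg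
  obtain ⟨θ, hθ, hiff⟩ := exists_armijoStep_iff_eq_one hα hβ hσ hm₀ hm hAz hC hδ hη hR
    fun u hu huz ζ hζ => ((h u hu huz).2.2 ζ hζ).1
  have hη' : ∀ {u : FlowVec J}, ‖u - z‖ < min η θ → ‖u - z‖ < η :=
    fun hu => hu.trans_le (min_le_left _ _)
  have hθ' : ∀ {u : FlowVec J}, ‖u - z‖ < min η θ → ‖u - z‖ < θ :=
    fun hu => hu.trans_le (min_le_right _ _)
  refine locallySuperlinear_of_quadratic hκ (lt_min hη hθ)
    (fun u hu huz => (h u hu (hη' huz)).1) ?_ ?_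
  · intro u hu huz hg
    obtain ⟨-, ⟨ζ, hζ⟩, -⟩ := h u hu (hη' huz)
    exact ⟨ζ, 1, hζ, (hiff u hu (hθ' huz) hg ζ hζ 1).2 rfl⟩
  · intro u hu huz hg ζ t hζ ht
    obtain rfl := (hiff u hu (hθ' huz) hg ζ hζ t).1 ht
    exact ⟨N.retract_mem ht.cond.1, ((h u hu (hη' huz)).2.2 ζ hζ).2.2.2⟩

end RadialNetwork

theorem proposition2 {J : ℕ} (N : RadialNetwork J) (ρ : QERetraction) (α β σ : ℝ)
    (hα : 0 < α) (hβ : β ∈ Set.Ioo (0 : ℝ) 1) (hσ : σ ∈ Set.Ioo (0 : ℝ) 1) :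
    -- approximate Newton method: the direction solves a perturbed Newton equation
    (∀ u ∈ N.MQE, ∀ ζ, N.IsDirection u ζ → (N.hess u + N.hessError u) ζ = -N.grad u) ∧
    -- and the perturbation is bounded by a multiple of the gradient
    (∀ K ⊆ N.MQE, IsCompact K → (∀ u ∈ K, N.RowsIndep u) →
      ∃ γ : ℝ, ∀ u ∈ K, ‖N.hessError u‖ ≤ γ * ‖N.grad u‖) ∧
    -- descent directions, and Armijo's rule finds a stepsize
    (∀ u ∈ N.MQE, ∀ ζ, N.IsDirection u ζ → N.f u ≠ 0 →
      inner ℝ (N.grad u) ζ < 0 ∧ ∃ t, N.ArmijoStep ρ α β σ u ζ t) ∧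
    -- descent at each iteration, on the manifold
    (∀ ε : ℝ, 0 ≤ ε → ∀ s, N.IsRun ρ (N.ArmijoStep ρ α β σ) ε s →
      ∀ k, s k ∈ N.MQE ∧ (ε < ‖N.grad (s k)‖ → N.f (s (k + 1)) < N.f (s k))) ∧
    -- accumulation points are critical
    (∀ s, N.IsRun ρ (N.ArmijoStep ρ α β σ) 0 s → ∀ z ∈ N.MQE, N.RowsIndep z →
      MapClusterPt z Filter.atTop s → N.grad z = 0) ∧
    -- local superlinear convergence to a load flow solution
    (∀ z ∈ N.MQE, N.A z = N.b → N.RowsIndep z →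
      N.LocallySuperlinear ρ (N.UnitStep ρ) z ∧
      ((σ < 1 / 2 ∧ ∃ m₀ : ℕ, β ^ m₀ * α = 1 ∧ ∀ m < m₀, 2 * (1 - σ) < β ^ m * α) →
        N.LocallySuperlinear ρ (N.ArmijoStep ρ α β σ) z)) := by
  refine ⟨fun u hu ζ hζ => N.hess_add_hessError_apply hu.2 hζ,
    fun K hK hc hreg => N.exists_hessError_bound hK hc hreg,
    fun u hu ζ hζ hf => ⟨?_, RadialNetwork.exists_armijoStep ρ hα hβ hσ.2 hu hζ hf⟩,
    fun ε hε s hs k => ⟨hs.mem k, fun hg => hs.f_lt hα hβ.1 hσ.1 hε hg⟩,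
    fun s hs z hz hreg hcl => hs.grad_eq_zero_of_mapClusterPt hα hβ hσ hz hreg hcl,
    fun z hz hAz hreg => ⟨RadialNetwork.locallySuperlinear_unitStep ρ hz hAz hreg, ?_⟩⟩
  · have hpos : 0 < N.f u := lt_of_le_of_ne (sq_nonneg _) hf.symm
    rw [N.inner_grad_direction hζ]
    exact neg_neg_of_pos (mul_pos two_pos hpos)
  · rintro ⟨hσ', m₀, hm₀, hm⟩
    exact RadialNetwork.locallySuperlinear_armijoStep ρ hα hβ.1 hσ' hm₀ hm hz hAz hreg
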